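/- Let $\lambda, q > 0$ and $\sigma \in \mathbb{R}$, and let $v, \phi \in H^1(\mathbb{R}^2)$ be real-valued functions solving, in the sense of distributions on $\mathbb{R}^2$, the stationary system $$-\Delta v + 2\sigma v - 2v\sin(2\phi) = 0, \qquad -\lambda\Delta\phi + q\sin(2\phi) - 2|v|^2\cos(2\phi) = 0 .$$ Suppose that $v$ and $\phi$ are radial and radially decreasing (not necessarily strictly), i.e. $v(x) = v(|x|)$ and $\phi(x) = \phi(|x|)$ for almost every $x$, with radial profiles $v(r)$, $\phi(r)$ that are nonincreasing on $(0,\infty)$. Then $v, \phi \in H^k(\mathbb{R}^2)$ for every $k \in \mathbb{N}$, and both decay exponentially at infinity: there exist constants $m, R, C > 0$ such that for every $r > R$ $$|v(r)| \le C e^{-mr}, \qquad |\phi(r)| \le C e^{-mr}.$$ -/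

import Mathlib

open MeasureTheory
open scoped ContDiff SchwartzMap Laplacian

/-- The Euclidean plane `ℝ²`. -/
abbrev Plane : Type := EuclideanSpace ℝ (Fin 2)

/-- The real-valued function `u` on the plane belongs to the Sobolev space `H^k(ℝ²)`: it is
square-integrable, and the tempered distribution it defines is in the `L²`-based Sobolev space of
order `k`. -/
def MemH (k : ℕ) (u : Plane → ℝ) : Prop :=
  ∃ hu : MemLp (fun x => (u x : ℂ)) 2 (volume : Measure Plane),
    TemperedDistribution.MemSobolev (k : ℝ) 2 ((hu.toLp (fun x => (u x : ℂ)) :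
      Lp ℂ 2 (volume : Measure Plane)) : 𝓢'(Plane, ℂ))

/-- `f : (0, ∞) → ℝ` is a (nonstrictly) decreasing radial profile of the function `u`, considered
up to equality almost everywhere: `u(x) = f(|x|)` for almost every `x`. -/
structure IsDecreasingProfile (u : Plane → ℝ) (f : ℝ → ℝ) : Prop where
  antitoneOn : AntitoneOn f (Set.Ioi 0)
  ae_eq : ∀ᵐ x ∂(volume : Measure Plane), u x = f ‖x‖

/-- Smooth compactly supported real-valued test functions on the plane. -/
def IsTest (ψ : Plane → ℝ) : Prop := ContDiff ℝ ∞ ψ ∧ HasCompactSupport ψ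

/-- `(v, φ) ∈ H¹ × H¹` solves, in the sense of distributions, the stationary system
`-Δv + 2σv - 2v sin(2φ) = 0`, `-λΔφ + q sin(2φ) - 2|v|² cos(2φ) = 0` on `ℝ²`. -/
structure IsStationarySolution (lam q σ : ℝ) (v φ : Plane → ℝ) : Prop where
  v_mem : MemH 1 v
  φ_mem : MemH 1 φ
  v_eq : ∀ ψ : Plane → ℝ, IsTest ψ →
    (∫ x, v x * (-(Δ ψ) x)) +
      (∫ x, (2 * σ * v x - 2 * v x * Real.sin (2 * φ x)) * ψ x) = 0
  φ_eq : ∀ ψ : Plane → ℝ, IsTest ψ →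
    lam * (∫ x, φ x * (-(Δ ψ) x)) +
      (∫ x, (q * Real.sin (2 * φ x) - 2 * |v x| ^ 2 * Real.cos (2 * φ x)) * ψ x) = 0

/-! Regularity is run on the Fourier side. Since the sine is bounded, `Δv` is in `L²`, and in
dimension below 4 this makes `v̂` integrable (`weightedIntegrable_zero_of_memLp_two`). So `v` is
bounded, `v²` is in `L²`, and the same argument applies to `φ`. Functions whose transform is
integrable against `(1 + ‖ξ‖)^k` form an algebra stable under entire functions vanishing at 0
(`IsWiener.mul`, `IsWiener.cexp_sub_one`), so the right-hand sides inherit the weight of `v` and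
`φ`, and inverting the Laplacian improves it by two (`WeightedIntegrable.add_two`). Iteration gives
every weight, hence smooth representatives solving the system pointwise.

The profiles `f`, `g` of `v`, `φ` are nonnegative, nonincreasing and vanish at infinity, and they
solve the radial equations. Dropping `f'/r ≤ 0` leaves `f'' ≥ 2f(σ - sin 2g)`. If `σ > 0`,
eventually `f'' ≥ σf`, and an energy argument (`le_exp_of_deriv_two_ge`) gives exponential decay. If
`σ ≤ 0`, `f` is eventually superharmonic; comparison with the logarithm in the plane makes it vanish
there (`eq_zero_of_radial_superharmonic`). Next, `g'' ≥ (q/λ)g - Ke^{-2mr}`, and a multiple of the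
exponential added to `g` absorbs the error.

Decay is also what yields `H^k`: it puts `v` and `φ` in `L¹`, so their transforms are bounded, and
weighted `L¹` bounds become weighted `L²` bounds (`memH_of_integrable`). -/

/-! ### Weighted Wiener algebras -/

section WeightedFourier

open scoped FourierTransform Convolution

variable {E : Type*} [NormedAddCommGroup E] [InnerProductSpace ℝ E] [FiniteDimensional ℝ E]
  [MeasurableSpace E] [BorelSpace E]

/-- `w` is integrable with respect to the weight `(1 + ‖ξ‖) ^ k`. -/
def WeightedIntegrable (k : ℕ) (w : E → ℂ) : Prop :=
  AEStronglyMeasurable w volume ∧ Integrable (fun ξ => (1 + ‖ξ‖) ^ k * ‖w ξ‖)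

namespace WeightedIntegrable

variable {k : ℕ} {w z : E → ℂ}

theorem mono {l : ℕ} (hw : WeightedIntegrable k w) (hl : l ≤ k) : WeightedIntegrable l w := by
  refine ⟨hw.1, hw.2.mono' ?_ (Filter.Eventually.of_forall fun ξ => ?_)⟩
  · exact (by fun_prop : Continuous fun ξ : E => (1 + ‖ξ‖) ^ l).aestronglyMeasurable.mul hw.1.norm
  · rw [Real.norm_of_nonneg (by positivity)]
    gcongr
    linarith [norm_nonneg ξ]

theorem integrable (hw : WeightedIntegrable k w) : Integrable w := by
  have := (hw.mono (Nat.zero_le k)).2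
  simp only [pow_zero, one_mul] at this
  exact (integrable_norm_iff hw.1).1 this

theorem integrable_pow_mul (hw : WeightedIntegrable k w) {n : ℕ} (hn : n ≤ k) :
    Integrable (fun ξ => ‖ξ‖ ^ n * ‖w ξ‖) := by
  refine (hw.mono hn).2.mono' ?_ (Filter.Eventually.of_forall fun ξ => ?_)
  · exact (by fun_prop : Continuous fun ξ : E => ‖ξ‖ ^ n).aestronglyMeasurable.mul hw.1.norm
  · rw [Real.norm_of_nonneg (by positivity)]
    gcongr
    linarith [norm_nonneg ξ]

theorem congr (hw : WeightedIntegrable k w) (h : w =ᵐ[volume] z) : WeightedIntegrable k z :=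
  ⟨hw.1.congr h, hw.2.congr (h.mono fun ξ hξ => by simp only [hξ])⟩

theorem add (hw : WeightedIntegrable k w) (hz : WeightedIntegrable k z) :
    WeightedIntegrable k (fun ξ => w ξ + z ξ) := by
  refine ⟨hw.1.add hz.1, (hw.2.add hz.2).mono' ?_ (Filter.Eventually.of_forall fun ξ => ?_)⟩
  · exact (by fun_prop : Continuous fun ξ : E => (1 + ‖ξ‖) ^ k).aestronglyMeasurable.mul
      (hw.1.add hz.1).norm
  · rw [Real.norm_of_nonneg (by positivity), Pi.add_apply, ← mul_add]
    gcongr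
    exact norm_add_le _ _

theorem const_mul (hw : WeightedIntegrable k w) (c : ℂ) :
    WeightedIntegrable k (fun ξ => c * w ξ) := by
  refine ⟨hw.1.const_mul c, (hw.2.const_mul ‖c‖).congr (Filter.Eventually.of_forall fun ξ => ?_)⟩
  simp only [norm_mul]
  ring

/-- The weight is submultiplicative: `1 + ‖ξ‖ ≤ (1 + ‖t‖)(1 + ‖ξ - t‖)`. The norm bound is what lets
power series converge. -/
theorem convolution (hw : WeightedIntegrable k w) (hz : WeightedIntegrable k z) :
    WeightedIntegrable k (w ⋆[ContinuousLinearMap.mul ℂ ℂ] z) ∧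
      ∫ ξ, (1 + ‖ξ‖) ^ k * ‖(w ⋆[ContinuousLinearMap.mul ℂ ℂ] z) ξ‖ ≤
        (∫ ξ, (1 + ‖ξ‖) ^ k * ‖w ξ‖) * ∫ ξ, (1 + ‖ξ‖) ^ k * ‖z ξ‖ := by
  set W : E → ℝ := fun ξ => (1 + ‖ξ‖) ^ k * ‖w ξ‖
  set Z : E → ℝ := fun ξ => (1 + ‖ξ‖) ^ k * ‖z ξ‖
  have hint : Integrable (w ⋆[ContinuousLinearMap.mul ℂ ℂ] z) :=
    hw.integrable.integrable_convolution _ hz.integrable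
  have hWZ : Integrable (W ⋆[ContinuousLinearMap.mul ℝ ℝ] Z) := hw.2.integrable_convolution _ hz.2
  have hex := Integrable.ae_convolution_exists (ContinuousLinearMap.mul ℝ ℝ) hw.2 hz.2
  have hle : ∀ᵐ ξ, (1 + ‖ξ‖) ^ k * ‖(w ⋆[ContinuousLinearMap.mul ℂ ℂ] z) ξ‖ ≤
      (W ⋆[ContinuousLinearMap.mul ℝ ℝ] Z) ξ := by
    filter_upwards [hex] with ξ hξ
    have h1 : ‖(w ⋆[ContinuousLinearMap.mul ℂ ℂ] z) ξ‖ ≤ ∫ t, ‖w t‖ * ‖z (ξ - t)‖ := by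
      refine (norm_integral_le_integral_norm _).trans_eq ?_
      simp
    calc _ ≤ (1 + ‖ξ‖) ^ k * ∫ t, ‖w t‖ * ‖z (ξ - t)‖ := by gcongr
      _ = ∫ t, (1 + ‖ξ‖) ^ k * (‖w t‖ * ‖z (ξ - t)‖) := by rw [integral_const_mul]
      _ ≤ ∫ t, W t * Z (ξ - t) := by
        refine integral_mono_of_nonneg (Filter.Eventually.of_forall fun t => by positivity) ?_
          (Filter.Eventually.of_forall fun t => ?_)
        · simpa [ConvolutionExistsAt] using hξ
        · have : 1 + ‖ξ‖ ≤ (1 + ‖t‖) * (1 + ‖ξ - t‖) := by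
            have := norm_add_le t (ξ - t)
            rw [add_sub_cancel] at this
            nlinarith [norm_nonneg t, norm_nonneg (ξ - t),
              mul_nonneg (norm_nonneg t) (norm_nonneg (ξ - t))]
          have h2 : (1 + ‖ξ‖) ^ k ≤ (1 + ‖t‖) ^ k * (1 + ‖ξ - t‖) ^ k := by
            rw [← mul_pow]
            gcongr
          calc _ ≤ ((1 + ‖t‖) ^ k * (1 + ‖ξ - t‖) ^ k) * (‖w t‖ * ‖z (ξ - t)‖) := by
                dsimp only
                gcongr
            _ = W t * Z (ξ - t) := by simp only [W, Z]; ring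
      _ = _ := by simp [MeasureTheory.convolution]
  have hI : Integrable fun ξ => (1 + ‖ξ‖) ^ k * ‖(w ⋆[ContinuousLinearMap.mul ℂ ℂ] z) ξ‖ := by
    refine hWZ.mono' ?_ ?_
    · exact (by fun_prop : Continuous fun ξ : E => (1 + ‖ξ‖) ^ k).aestronglyMeasurable.mul
        hint.1.norm
    · filter_upwards [hle] with ξ hξ
      rwa [Real.norm_of_nonneg (by positivity)]
  refine ⟨⟨hint.1, hI⟩, (integral_mono_ae hI hWZ hle).trans_eq ?_⟩
  exact integral_convolution (ContinuousLinearMap.mul ℝ ℝ) hw.2 hz.2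

/-- Completeness of weighted `L¹`. As the weight is at least 1, the series converges absolutely
almost everywhere, which makes the pointwise sum measurable. -/
theorem tsum {w : ℕ → E → ℂ} (hw : ∀ n, WeightedIntegrable k (w n))
    (hs : Summable fun n => ∫ ξ, (1 + ‖ξ‖) ^ k * ‖w n ξ‖) :
    WeightedIntegrable k (fun ξ => ∑' n, w n ξ) := by
  have hfin : ∑' n, ∫⁻ ξ, ‖((1 + ‖ξ‖) ^ k * ‖w n ξ‖ : ℝ)‖ₑ ≠ ⊤ := by
    have (n : ℕ) : ∫⁻ ξ, ‖((1 + ‖ξ‖) ^ k * ‖w n ξ‖ : ℝ)‖ₑ =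
        ENNReal.ofReal (∫ ξ, (1 + ‖ξ‖) ^ k * ‖w n ξ‖) := by
      rw [← ofReal_integral_norm_eq_lintegral_enorm (hw n).2]
      congr 2
      ext ξ
      exact Real.norm_of_nonneg (by positivity)
    simp_rw [this]
    exact hs.tsum_ofReal_ne_top
  have hmeas (n : ℕ) : AEMeasurable (fun ξ => ‖((1 + ‖ξ‖) ^ k * ‖w n ξ‖ : ℝ)‖ₑ) :=
    (hw n).2.1.enorm
  rw [← lintegral_tsum hmeas] at hfin
  have hae : ∀ᵐ ξ, Summable fun n => ‖w n ξ‖ := by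
    filter_upwards [ae_lt_top' (AEMeasurable.tsum hmeas) hfin] with ξ hξ
    have := tsum_enorm_ne_top_iff_summable_norm.1 hξ.ne
    refine this.of_nonneg_of_le (fun _ => norm_nonneg _) fun n => ?_
    rw [Real.norm_of_nonneg (by positivity)]
    exact le_mul_of_one_le_left (norm_nonneg _)
      (one_le_pow₀ (by linarith [norm_nonneg ξ]))
  have hm : AEStronglyMeasurable (fun ξ => ∑' n, w n ξ) volume := by
    refine aestronglyMeasurable_of_tendsto_ae Filter.atTop
      (f := fun n ξ => ∑ i ∈ Finset.range n, w i ξ) (fun n => ?_) ?_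
    · exact Finset.aestronglyMeasurable_fun_sum _ fun i _ => (hw i).1
    · filter_upwards [hae] with ξ hξ
      exact hξ.of_norm.hasSum.tendsto_sum_nat
  have hm' : AEStronglyMeasurable (fun ξ => (1 + ‖ξ‖) ^ k * ‖∑' n, w n ξ‖) volume :=
    (by fun_prop : Continuous fun ξ : E => (1 + ‖ξ‖) ^ k).aestronglyMeasurable.mul hm.norm
  refine ⟨hm, hm', ?_⟩
  refine lt_of_le_of_lt (lintegral_mono fun ξ => ?_) hfin.lt_top
  rw [enorm_mul, enorm_norm]
  calc _ ≤ ‖(1 + ‖ξ‖) ^ k‖ₑ * ∑' n, ‖w n ξ‖ₑ := by gcongr; exact enorm_tsum_le_tsum_enorm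
    _ = _ := by
      rw [← ENNReal.tsum_mul_left]
      simp only [enorm_mul, enorm_norm]

end WeightedIntegrable

/-- `u` is the inverse Fourier integral of a function that is integrable with respect to the weight
`(1 + ‖ξ‖) ^ k`. -/
def IsWiener (k : ℕ) (u : E → ℂ) : Prop :=
  ∃ w : E → ℂ, WeightedIntegrable k w ∧ ∀ x, u x = 𝓕⁻ w x

theorem fourierInv_mul_convolution_eq {w z : E → ℂ} (hw : Integrable w) (hz : Integrable z)
    (x : E) :
    𝓕⁻ (w ⋆[ContinuousLinearMap.mul ℂ ℂ] z) x = 𝓕⁻ w x * 𝓕⁻ z x := by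
  simp only [Real.fourierInv_eq_fourier_neg, Real.fourier_mul_convolution_eq hw hz]

theorem hasSum_fourierInv {w : ℕ → E → ℂ} (hw : ∀ n, Integrable (w n))
    (hs : Summable fun n => ∫ ξ, ‖w n ξ‖) (x : E) :
    HasSum (fun n => 𝓕⁻ (w n) x) (𝓕⁻ (fun ξ => ∑' n, w n ξ) x) := by
  simp only [Real.fourierInv_eq]
  have hi (n : ℕ) : Integrable fun ξ => Real.fourierChar (inner ℝ ξ x) • w n ξ := by
    have := (Real.fourierIntegral_convergent_iff (-x)).2 (hw n)
    simpa using this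
  have := hasSum_integral_of_summable_integral_norm hi (by simpa using hs)
  simpa only [tsum_const_smul'] using this

namespace IsWiener

variable {k : ℕ} {u v : E → ℂ}

theorem add (hu : IsWiener k u) (hv : IsWiener k v) : IsWiener k (fun x => u x + v x) := by
  obtain ⟨w, hw, hu⟩ := hu
  obtain ⟨z, hz, hv⟩ := hv
  refine ⟨_, hw.add hz, fun x => ?_⟩
  dsimp only
  rw [hu, hv]
  simp only [Real.fourierInv_eq, smul_add]
  have h {w : E → ℂ} (hw : WeightedIntegrable k w) :
      Integrable fun ξ => Real.fourierChar (inner ℝ ξ x) • w ξ := by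
    simpa using (Real.fourierIntegral_convergent_iff (-x)).2 hw.integrable
  exact (integral_add (h hw) (h hz)).symm

theorem const_mul (hu : IsWiener k u) (c : ℂ) : IsWiener k (fun x => c * u x) := by
  obtain ⟨w, hw, hu⟩ := hu
  refine ⟨_, hw.const_mul c, fun x => ?_⟩
  dsimp only
  rw [hu]
  simp only [Real.fourierInv_eq, Circle.smul_def, smul_eq_mul]
  rw [← integral_const_mul]
  congr with ξ
  ring

theorem mul (hu : IsWiener k u) (hv : IsWiener k v) : IsWiener k (fun x => u x * v x) := by
  obtain ⟨w, hw, hu⟩ := hu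
  obtain ⟨z, hz, hv⟩ := hv
  refine ⟨_, (hw.convolution hz).1, fun x => ?_⟩
  dsimp only
  rw [hu, hv, fourierInv_mul_convolution_eq hw.integrable hz.integrable]

/-- The exponential series is summed through iterated convolutions. The constant term must go: the
transform of 1 is a Dirac mass, not an integrable function. -/
theorem cexp_sub_one (hu : IsWiener k u) : IsWiener k (fun x => Complex.exp (u x) - 1) := by
  obtain ⟨w, hw, hu⟩ := hu
  let N : ℝ := ∫ ξ, (1 + ‖ξ‖) ^ k * ‖w ξ‖
  -- `W n` is the convolution power of order `n + 1`, representing `u ^ (n + 1)`.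
  let W : ℕ → E → ℂ := fun n =>
    Nat.rec w (fun _ z => w ⋆[ContinuousLinearMap.mul ℂ ℂ] z) n
  have hN : 0 ≤ N := integral_nonneg fun ξ => by positivity
  have hW (n : ℕ) : WeightedIntegrable k (W n) ∧
      ∫ ξ, (1 + ‖ξ‖) ^ k * ‖W n ξ‖ ≤ N ^ (n + 1) ∧ ∀ x, 𝓕⁻ (W n) x = u x ^ (n + 1) := by
    induction n with
    | zero => exact ⟨hw, by simp [W, N], fun x => by simp [W, hu]⟩
    | succ n ih =>
      obtain ⟨h1, h2, h3⟩ := ih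
      obtain ⟨h4, h5⟩ := hw.convolution h1
      refine ⟨h4, h5.trans ?_, fun x => ?_⟩
      · rw [pow_succ' N]
        exact mul_le_mul_of_nonneg_left h2 hN
      · rw [pow_succ', ← h3, hu, ← fourierInv_mul_convolution_eq hw.integrable h1.integrable]
  let c : ℕ → ℂ := fun n => ((n + 1).factorial : ℂ)⁻¹
  -- Used at `l = k` for the weight of the sum and at `l = 0` to exchange sum and inverse transform.
  have hsum (l : ℕ) (hl : l ≤ k) :
      Summable fun n => ∫ ξ, (1 + ‖ξ‖) ^ l * ‖c n * W n ξ‖ := by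
    have hS : Summable fun n : ℕ => N ^ (n + 1) / (n + 1).factorial :=
      (summable_nat_add_iff 1).2 (Real.summable_pow_div_factorial N)
    refine hS.of_nonneg_of_le (fun n => integral_nonneg fun ξ => by positivity) fun n => ?_
    have h1 : ∫ ξ, (1 + ‖ξ‖) ^ l * ‖c n * W n ξ‖ =
        ((n + 1).factorial : ℝ)⁻¹ * ∫ ξ, (1 + ‖ξ‖) ^ l * ‖W n ξ‖ := by
      rw [← integral_const_mul]
      congr with ξ
      simp only [c, norm_mul, norm_inv, Complex.norm_natCast]
      ring
    have h2 : ∫ ξ, (1 + ‖ξ‖) ^ l * ‖W n ξ‖ ≤ ∫ ξ, (1 + ‖ξ‖) ^ k * ‖W n ξ‖ :=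
      integral_mono ((hW n).1.mono hl).2 (hW n).1.2 fun ξ => by
        dsimp only
        gcongr
        linarith [norm_nonneg ξ]
    rw [h1, div_eq_inv_mul]
    gcongr
    exact h2.trans (hW n).2.1
  refine ⟨_, WeightedIntegrable.tsum (fun n => (hW n).1.const_mul (c n)) (hsum k le_rfl),
    fun x => ?_⟩
  have h := hasSum_fourierInv (fun n => ((hW n).1.const_mul (c n)).integrable)
    (by simpa using hsum 0 (Nat.zero_le k)) x
  have hterm (n : ℕ) : 𝓕⁻ (fun ξ => c n * W n ξ) x = u x ^ (n + 1) / (n + 1).factorial := by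
    rw [← (hW n).2.2]
    simp only [Real.fourierInv_eq, Circle.smul_def, smul_eq_mul, c]
    rw [div_eq_inv_mul, ← integral_const_mul]
    congr with ξ
    ring
  simp only [hterm] at h
  have he := NormedSpace.expSeries_div_hasSum_exp (u x)
  rw [← Complex.exp_eq_exp_ℂ] at he
  have he' := (hasSum_nat_add_iff' 1).2 he
  simp only [Finset.range_one, Finset.sum_singleton, pow_zero, Nat.factorial_zero, Nat.cast_one,
    div_one] at he'
  exact he'.unique h

theorem congr (hu : IsWiener k u) (h : ∀ x, u x = v x) : IsWiener k v := by
  obtain ⟨w, hw, hu⟩ := hu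
  exact ⟨w, hw, fun x => by rw [← h, hu]⟩

theorem csin (hu : IsWiener k u) : IsWiener k (fun x => Complex.sin (u x)) := by
  have h (c : ℂ) := (hu.const_mul c).cexp_sub_one
  refine (((h (-Complex.I)).const_mul (Complex.I / 2)).add
    ((h Complex.I).const_mul (-Complex.I / 2))).congr fun x => ?_
  rw [Complex.sin, mul_comm (-Complex.I), mul_comm Complex.I (u x)]
  ring_nf

theorem ccos_sub_one (hu : IsWiener k u) : IsWiener k (fun x => Complex.cos (u x) - 1) := by
  have h (c : ℂ) := (hu.const_mul c).cexp_sub_one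
  refine (((h (-Complex.I)).const_mul (1 / 2)).add
    ((h Complex.I).const_mul (1 / 2))).congr fun x => ?_
  rw [Complex.cos, mul_comm (-Complex.I), mul_comm Complex.I (u x)]
  ring_nf

end IsWiener

end WeightedFourier

/-! ### From compactly supported to Schwartz test functions -/

section LaplacianTesting

variable {E : Type*} [NormedAddCommGroup E] [InnerProductSpace ℝ E] [FiniteDimensional ℝ E]
variable {F : Type*} [NormedAddCommGroup F] [NormedSpace ℝ F]

theorem norm_laplacian_le (f : E → F) (x : E) :
    ‖Δ f x‖ ≤ Module.finrank ℝ E * ‖iteratedFDeriv ℝ 2 f x‖ := by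
  rw [InnerProductSpace.laplacian_eq_iteratedFDeriv_stdOrthonormalBasis]
  refine (norm_sum_le _ _).trans ?_
  refine (Finset.sum_le_card_nsmul _ _ ‖iteratedFDeriv ℝ 2 f x‖ fun i _ => ?_).trans_eq (by simp)
  refine (ContinuousMultilinearMap.le_opNorm _ _).trans_eq ?_
  simp [Fin.prod_univ_two]

theorem ContDiff.continuous_laplacian {f : E → F} (hf : ContDiff ℝ 2 f) : Continuous (Δ f) := by
  rw [InnerProductSpace.laplacian_eq_iteratedFDeriv_stdOrthonormalBasis]
  have := hf.continuous_iteratedFDeriv (m := 2) le_rfl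
  fun_prop

theorem HasCompactSupport.laplacian {f : E → F} (hf : HasCompactSupport f) :
    HasCompactSupport (Δ f) := by
  refine (hf.iteratedFDeriv (𝕜 := ℝ) 2).mono fun x hx h => hx ?_
  have := norm_laplacian_le f x
  rw [h, norm_zero, mul_zero] at this
  simpa using this

variable [MeasurableSpace E] [BorelSpace E]

theorem integrable_mul_iteratedFDeriv_schwartz {u : E → ℝ} (hu : MemLp u 2) (s : 𝓢(E, ℂ))
    (j : ℕ) : Integrable fun x => |u x| * ‖iteratedFDeriv ℝ j s x‖ := by
  have hc : Continuous fun x => ‖iteratedFDeriv ℝ j s x‖ :=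
    ((s.smooth ⊤).continuous_iteratedFDeriv (mod_cast le_top)).norm
  have h1 : Integrable fun x => ‖iteratedFDeriv ℝ j s x‖ := by
    simpa using s.integrable_pow_mul_iteratedFDeriv volume 0 j
  obtain ⟨C, hC⟩ := s.decay 0 j
  have h2 : MemLp (fun x => ‖iteratedFDeriv ℝ j s x‖) 2 := by
    rw [memLp_two_iff_integrable_sq hc.aestronglyMeasurable]
    refine (h1.const_mul C).mono' (hc.pow 2).aestronglyMeasurable
      (Filter.Eventually.of_forall fun x => ?_)
    rw [Real.norm_of_nonneg (by positivity), sq]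
    gcongr
    simpa using hC.2 x
  exact hu.norm.integrable_mul h2

/-- An identity `Δ u = h` between square-integrable functions which holds against real-valued
smooth compactly supported functions holds against Schwartz functions. -/
theorem integral_laplacian_schwartz_eq {u h : E → ℝ} (hu : MemLp u 2) (hh : MemLp h 2)
    (H : ∀ ψ : E → ℝ, ContDiff ℝ ∞ ψ → HasCompactSupport ψ →
      ∫ x, Δ ψ x * u x = ∫ x, ψ x * h x) (s : 𝓢(E, ℂ)) :
    ∫ x, Δ (s : E → ℂ) x * u x = ∫ x, s x * h x := by
  have hul : LocallyIntegrable u := hu.locallyIntegrable (by norm_num)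
  have hhl : LocallyIntegrable h := hh.locallyIntegrable (by norm_num)
  have Hc (f : E → ℂ) (hf : ContDiff ℝ ∞ f) (hf' : HasCompactSupport f) :
      ∫ x, Δ f x * u x = ∫ x, f x * h x := by
    have hf2 : ContDiff ℝ 2 f := hf.of_le (WithTop.coe_le_coe.2 (le_top : (2 : ℕ∞) ≤ ⊤))
    have i1 : Integrable fun x => Δ f x * u x := by
      simpa [mul_comm] using hul.integrable_smul_right_of_hasCompactSupport
        hf2.continuous_laplacian hf'.laplacian
    have i2 : Integrable fun x => f x * h x := by
      simpa [mul_comm] using hhl.integrable_smul_right_of_hasCompactSupport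
        hf.continuous hf'
    apply Complex.ext
    · have := H (Complex.reCLM ∘ f) (by fun_prop) (hf'.comp_left (by simp))
      rw [← Complex.reCLM_apply, ← Complex.reCLM_apply, ← Complex.reCLM.integral_comp_comm i1,
        ← Complex.reCLM.integral_comp_comm i2]
      convert this using 3 with x x
      · rw [hf2.contDiffAt.laplacian_CLM_comp_left]; simp
      · simp
    · have := H (Complex.imCLM ∘ f) (by fun_prop) (hf'.comp_left (by simp))
      rw [← Complex.imCLM_apply, ← Complex.imCLM_apply, ← Complex.imCLM.integral_comp_comm i1,
        ← Complex.imCLM.integral_comp_comm i2]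
      convert this using 3 with x x
      · rw [hf2.contDiffAt.laplacian_CLM_comp_left]; simp
      · simp
  -- Truncate `s` by the dilated cutoffs `χ(x / (n + 1))` and pass to the limit by dominated
  -- convergence.
  let χ : ContDiffBump (0 : E) := ⟨1, 2, by norm_num, by norm_num⟩
  have hχ : ContDiff ℝ ∞ χ := χ.contDiff
  let a : ℕ → ℝ := fun n => ((n : ℝ) + 1)⁻¹
  have ha0 (n : ℕ) : 0 < a n := by positivity
  have ha1 (n : ℕ) : a n ≤ 1 := inv_le_one_of_one_le₀ (by linarith [n.cast_nonneg (α := ℝ)])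
  let S : ℕ → E → ℂ := fun n x => χ (a n • x) • s x
  have hs : ContDiff ℝ ∞ s := s.smooth'
  have hχn (n : ℕ) : ContDiff ℝ ∞ fun x => χ (a n • x) := hχ.comp (by fun_prop)
  have hS (n : ℕ) : ContDiff ℝ ∞ (S n) := (hχn n).smul hs
  have hS' (n : ℕ) : HasCompactSupport (S n) :=
    (χ.hasCompactSupport.comp_smul (ha0 n).ne').smul_right
  -- Agreement on a neighbourhood, not just at `x`, so that the Laplacians agree as well.
  have hnear (x : E) : ∀ᶠ n in Filter.atTop, S n =ᶠ[nhds x] s := by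
    obtain ⟨N, hN⟩ := exists_nat_gt (‖x‖ + 1)
    filter_upwards [Filter.eventually_ge_atTop N] with n hn
    filter_upwards [Metric.ball_mem_nhds x one_pos] with y hy
    have hy' : ‖y‖ ≤ n + 1 := by
      have h1 := norm_le_norm_add_norm_sub' y x
      have h2 : ‖y - x‖ < 1 := by simpa [dist_eq_norm] using hy
      have h3 : (N : ℝ) ≤ n := by exact_mod_cast hn
      linarith
    have : χ (a n • y) = 1 := by
      apply χ.one_of_mem_closedBall
      rw [mem_closedBall_zero_iff, norm_smul, Real.norm_of_nonneg (ha0 n).le]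
      exact (inv_mul_le_one₀ (by positivity)).2 hy'
    simp [S, this]
  obtain ⟨C, hC⟩ : ∃ C : ℝ, ∀ j ≤ 2, ∀ x, ‖iteratedFDeriv ℝ j χ x‖ ≤ C := by
    have h (j : ℕ) : ∃ C : ℝ, ∀ x, ‖iteratedFDeriv ℝ j χ x‖ ≤ C :=
      (χ.hasCompactSupport.iteratedFDeriv j).exists_bound_of_continuous
        (hχ.continuous_iteratedFDeriv (by exact_mod_cast le_top))
    choose C hC using h
    refine ⟨max (C 0) (max (C 1) (C 2)), fun j hj x => (hC j x).trans ?_⟩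
    interval_cases j <;> simp
  have hC0 : 0 ≤ C := (norm_nonneg _).trans (hC 0 (by norm_num) 0)
  have hCn (n j : ℕ) (hj : j ≤ 2) (x : E) :
      ‖iteratedFDeriv ℝ j (fun x => χ (a n • x)) x‖ ≤ C := by
    rw [iteratedFDeriv_comp_const_smul (a n) (hχ.of_le (by exact_mod_cast le_top)), norm_smul,
      Real.norm_of_nonneg (by positivity)]
    exact (mul_le_of_le_one_left (norm_nonneg _) (pow_le_one₀ (ha0 n).le (ha1 n))).trans (hC j hj _)
  let d : ℝ := Module.finrank ℝ E
  -- The Leibniz bound for second derivatives of `S n`; it is uniform in `n` because dilation by `a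
  -- n ≤ 1` does not increase derivatives of `χ`.
  let B : E → ℝ := fun x => d * ∑ i ∈ Finset.range 3,
    (Nat.choose 2 i : ℝ) * C * ‖iteratedFDeriv ℝ (2 - i) s x‖
  have hB (n : ℕ) (x : E) : ‖Δ (S n) x‖ ≤ B x := by
    refine (norm_laplacian_le _ _).trans ?_
    refine mul_le_mul_of_nonneg_left ?_ (Nat.cast_nonneg _)
    refine (norm_iteratedFDeriv_smul_le (hχn n) hs x
      (WithTop.coe_le_coe.2 (le_top : (2 : ℕ∞) ≤ ⊤))).trans ?_
    refine Finset.sum_le_sum fun i hi => ?_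
    gcongr
    exact hCn n i (by simp at hi; omega) x
  have t1 : Filter.Tendsto (fun n => ∫ x, Δ (S n) x * u x) Filter.atTop
      (nhds (∫ x, Δ (s : E → ℂ) x * u x)) := by
    refine tendsto_integral_of_dominated_convergence (fun x => B x * |u x|) (fun n => ?_) ?_
      (fun n => Filter.Eventually.of_forall fun x => ?_) (Filter.Eventually.of_forall fun x => ?_)
    · exact ((hS n).of_le (WithTop.coe_le_coe.2
        (le_top : (2 : ℕ∞) ≤ ⊤))).continuous_laplacian.aestronglyMeasurable.mul
        (Complex.continuous_ofReal.comp_aestronglyMeasurable hu.1)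
    · simp only [B, mul_assoc, Finset.sum_mul]
      refine (integrable_finsetSum _ fun i _ => ?_).const_mul d
      refine Integrable.const_mul (Integrable.const_mul ?_ _) _
      simpa only [mul_comm] using integrable_mul_iteratedFDeriv_schwartz hu s (2 - i)
    · rw [norm_mul, Complex.norm_real, Real.norm_eq_abs]
      gcongr
      exact hB n x
    · refine tendsto_const_nhds.congr' ?_
      filter_upwards [hnear x] with n hn
      rw [(InnerProductSpace.laplacian_congr_nhds hn).eq_of_nhds]
  have t2 : Filter.Tendsto (fun n => ∫ x, S n x * h x) Filter.atTop
      (nhds (∫ x, s x * h x)) := by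
    refine tendsto_integral_of_dominated_convergence (fun x => ‖s x‖ * |h x|) (fun n => ?_) ?_
      (fun n => Filter.Eventually.of_forall fun x => ?_) (Filter.Eventually.of_forall fun x => ?_)
    · exact (hS n).continuous.aestronglyMeasurable.mul
        (Complex.continuous_ofReal.comp_aestronglyMeasurable hh.1)
    · simpa [mul_comm] using integrable_mul_iteratedFDeriv_schwartz hh s 0
    · rw [norm_mul, Complex.norm_real, Real.norm_eq_abs, norm_smul,
        Real.norm_of_nonneg χ.nonneg]
      gcongr
      exact mul_le_of_le_one_left (norm_nonneg _) χ.le_one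
    · refine tendsto_const_nhds.congr' ?_
      filter_upwards [hnear x] with n hn
      rw [hn.eq_of_nhds]
  refine tendsto_nhds_unique t1 (t2.congr fun n => ?_)
  exact (Hc _ (hS n) (hS' n)).symm

end LaplacianTesting

/-! ### The `L²` Fourier transform by duality -/

section LTwoFourier

open scoped FourierTransform

variable {E : Type*} [NormedAddCommGroup E] [InnerProductSpace ℝ E] [FiniteDimensional ℝ E]
  [MeasurableSpace E] [BorelSpace E]

theorem integral_fourier_mul_eq {f g : E → ℂ} (hf : Integrable f) (hg : Integrable g) :
    ∫ ξ, 𝓕 f ξ * g ξ = ∫ x, f x * 𝓕 g x := by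
  simpa using! VectorFourier.integral_fourierIntegral_smul_eq_flip (L := innerₗ E)
    Real.continuous_fourierChar continuous_inner hf hg

theorem integral_fourierInv_mul_eq {f g : E → ℂ} (hf : Integrable f) (hg : Integrable g) :
    ∫ ξ, 𝓕⁻ f ξ * g ξ = ∫ x, f x * 𝓕⁻ g x := by
  have := integral_fourier_mul_eq hf hg.comp_neg
  rw [← integral_neg_eq_self] at this
  rw [Real.fourierInv_eq_fourier_comp_neg g]
  simpa [Real.fourierInv_eq_fourier_neg f] using this

theorem continuous_fourierInv {w : E → ℂ} (hw : Integrable w) : Continuous (𝓕⁻ w) := by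
  have : Continuous (𝓕 w) := VectorFourier.fourierIntegral_continuous Real.continuous_fourierChar
    continuous_inner hw
  rw [Real.fourierInv_eq_fourier_comp_neg]
  exact VectorFourier.fourierIntegral_continuous Real.continuous_fourierChar
    continuous_inner hw.comp_neg

theorem continuous_fourier {w : E → ℂ} (hw : Integrable w) : Continuous (𝓕 w) :=
  VectorFourier.fourierIntegral_continuous Real.continuous_fourierChar continuous_inner hw

/-- A complex-valued function is determined almost everywhere by its integrals against Schwartz
functions. -/
theorem ae_eq_of_integral_schwartz_mul_eq {f g : E → ℂ} (hf : LocallyIntegrable f)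
    (hg : LocallyIntegrable g) (h : ∀ s : 𝓢(E, ℂ), ∫ x, s x * f x = ∫ x, s x * g x) :
    f =ᵐ[volume] g := by
  refine ae_eq_of_integral_contDiff_smul_eq hf hg fun ψ hψ hψ' => ?_
  have h1 : HasCompactSupport (Complex.ofRealCLM ∘ ψ) := hψ'.comp_left rfl
  have h2 : ContDiff ℝ ∞ (Complex.ofRealCLM ∘ ψ) := by fun_prop
  simpa using h (h1.toSchwartzMap h2)

theorem Lp.locallyIntegrable_two (u : Lp ℂ 2 (volume : Measure E)) : LocallyIntegrable u :=
  (Lp.memLp u).locallyIntegrable (by norm_num)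

theorem integral_fourier_schwartz_mul (u : Lp ℂ 2 (volume : Measure E)) (s : 𝓢(E, ℂ)) :
    ∫ x, 𝓕 (s : E → ℂ) x * u x =
      ∫ ξ, s ξ * (𝓕 u : Lp ℂ 2 (volume : Measure E)) ξ := by
  have := congrArg (fun T : 𝓢'(E, ℂ) => T s) (Lp.fourier_toTemperedDistribution_eq u)
  simpa [TemperedDistribution.fourier_apply, SchwartzMap.fourier_coe] using this

/-- Tested against a Schwartz function, the inverse transform moves onto that function and cancels
the transform defining `𝓕 u`. -/
theorem ae_eq_fourierInv_of_integrable (u : Lp ℂ 2 (volume : Measure E))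
    (hw : Integrable (𝓕 u : Lp ℂ 2 (volume : Measure E))) :
    u =ᵐ[volume] 𝓕⁻ ((𝓕 u : Lp ℂ 2 (volume : Measure E)) : E → ℂ) := by
  refine ae_eq_of_integral_schwartz_mul_eq (Lp.locallyIntegrable_two u)
    (continuous_fourierInv hw).locallyIntegrable fun s => ?_
  rw [← integral_fourierInv_mul_eq s.integrable hw, ← SchwartzMap.fourierInv_coe,
    ← integral_fourier_schwartz_mul, ← SchwartzMap.fourier_coe,
    FourierTransform.fourier_fourierInv_eq]

theorem fourier_ae_eq_of_ae_eq_fourierInv (u : Lp ℂ 2 (volume : Measure E)) {w : E → ℂ}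
    (hw : Integrable w) (h : u =ᵐ[volume] 𝓕⁻ w) :
    (𝓕 u : Lp ℂ 2 (volume : Measure E)) =ᵐ[volume] w := by
  refine ae_eq_of_integral_schwartz_mul_eq (Lp.locallyIntegrable_two _) hw.locallyIntegrable
    fun s => ?_
  rw [← integral_fourier_schwartz_mul]
  calc _ = ∫ x, 𝓕 (s : E → ℂ) x * 𝓕⁻ w x :=
        integral_congr_ae (h.mono fun x hx => by simp only [hx])
    _ = _ := by
      rw [← SchwartzMap.fourier_coe, ← integral_fourierInv_mul_eq (𝓕 s).integrable hw,
        ← SchwartzMap.fourierInv_coe, FourierTransform.fourierInv_fourier_eq]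

theorem fourier_ae_eq_fourier_of_integrable (u : Lp ℂ 2 (volume : Measure E))
    (hu : Integrable u) :
    (𝓕 u : Lp ℂ 2 (volume : Measure E)) =ᵐ[volume] 𝓕 (u : E → ℂ) := by
  refine ae_eq_of_integral_schwartz_mul_eq (Lp.locallyIntegrable_two _)
    (continuous_fourier hu).locallyIntegrable fun s => ?_
  rw [← integral_fourier_schwartz_mul, integral_fourier_mul_eq s.integrable hu]

/-- On tempered distributions the Laplacian is the Fourier multiplier `-(2π)²‖ξ‖²`; both sides are
functions, so the identity descends to almost every `ξ`. -/
theorem laplacian_fourier_ae_eq (u h : Lp ℂ 2 (volume : Measure E))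
    (H : ∀ s : 𝓢(E, ℂ), ∫ x, Δ (s : E → ℂ) x * u x = ∫ x, s x * h x) :
    ∀ᵐ ξ, -((2 * Real.pi) ^ 2 * ‖ξ‖ ^ 2 : ℂ) * (𝓕 u : Lp ℂ 2 (volume : Measure E)) ξ =
      (𝓕 h : Lp ℂ 2 (volume : Measure E)) ξ := by
  have hT : Δ (u : 𝓢'(E, ℂ)) = (h : 𝓢'(E, ℂ)) := by
    ext s
    simpa [SchwartzMap.laplacian_apply] using H s
  have hF := congrArg 𝓕 hT
  rw [TemperedDistribution.laplacian_eq_fourierMultiplierCLM,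
    TemperedDistribution.fourierMultiplierCLM_apply] at hF
  rw [← Complex.coe_smul, FourierTransform.fourier_smul, FourierTransform.fourier_fourierInv_eq,
    Lp.fourier_toTemperedDistribution_eq, Lp.fourier_toTemperedDistribution_eq] at hF
  refine ae_eq_of_integral_schwartz_mul_eq ?_ (Lp.locallyIntegrable_two _) fun s => ?_
  · exact (Lp.locallyIntegrable_two _).continuous_mul (by fun_prop)
  · have hg : (fun x : E => Complex.ofReal (‖x‖ ^ 2)).HasTemperateGrowth := by fun_prop
    have h1 := congrArg (fun T : 𝓢'(E, ℂ) => T s) hF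
    have h2 : ((-(2 * Real.pi) ^ 2 : ℝ) : ℂ) *
        ∫ ξ, SchwartzMap.smulLeftCLM ℂ (fun x : E => Complex.ofReal (‖x‖ ^ 2)) s ξ *
          (𝓕 u : Lp ℂ 2 (volume : Measure E)) ξ =
        ∫ ξ, s ξ * (𝓕 h : Lp ℂ 2 (volume : Measure E)) ξ := by
      simpa using h1
    rw [← h2, ← integral_const_mul]
    congr with ξ
    rw [SchwartzMap.smulLeftCLM_apply_apply hg]
    simp only [smul_eq_mul]
    push_cast
    ring

end LTwoFourier

/-! ### Elliptic gain and smooth representatives -/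

section SmoothRepresentative

open scoped FourierTransform

variable {E : Type*} [NormedAddCommGroup E] [InnerProductSpace ℝ E] [FiniteDimensional ℝ E]
  [MeasurableSpace E] [BorelSpace E]

theorem WeightedIntegrable.comp_neg {k : ℕ} {w : E → ℂ} (hw : WeightedIntegrable k w) :
    WeightedIntegrable k (fun ξ => w (-ξ)) :=
  ⟨hw.1.comp_measurePreserving (Measure.measurePreserving_neg volume), by
    simpa using hw.2.comp_neg⟩

/-- Differentiate twice under the integral along an orthonormal basis; the squared coordinates of
`ξ` add up to `‖ξ‖²`. -/
theorem laplacian_fourier {w : E → ℂ} (hw : WeightedIntegrable 2 w) (x : E) :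
    Δ (𝓕 w) x = 𝓕 (fun ξ => -((2 * Real.pi) ^ 2 * ‖ξ‖ ^ 2 : ℂ) * w ξ) x := by
  have hpow (n : ℕ) (hn : (n : ℕ∞) ≤ (2 : ℕ)) : Integrable (fun ξ => ‖ξ‖ ^ n * ‖w ξ‖) :=
    hw.integrable_pow_mul (by exact_mod_cast hn)
  have hi : Integrable (fun ξ => VectorFourier.fourierPowSMulRight (innerSL ℝ) w ξ 2) :=
    VectorFourier.integrable_fourierPowSMulRight _ (hw.integrable_pow_mul le_rfl) hw.1
  have hj (e : E) : Integrable fun ξ =>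
      VectorFourier.fourierPowSMulRight (innerSL ℝ) w ξ 2 ![e, e] :=
    (ContinuousMultilinearMap.apply ℝ (fun _ : Fin 2 => E) ℂ ![e, e]).integrable_comp hi
  rw [InnerProductSpace.laplacian_eq_iteratedFDeriv_stdOrthonormalBasis]
  dsimp only
  rw [Real.iteratedFDeriv_fourier hpow hw.1 (n := 2) le_rfl]
  simp only [Real.fourier_continuousMultilinearMap_apply hi]
  simp only [Real.fourier_eq]
  rw [← integral_finsetSum]
  · congr with ξ
    rw [← Finset.smul_sum]
    congr 1
    have hn : (‖ξ‖ : ℂ) ^ 2 = ∑ i, (inner ℝ ξ (stdOrthonormalBasis ℝ E i) : ℂ) ^ 2 := by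
      exact_mod_cast congrArg Complex.ofReal ((stdOrthonormalBasis ℝ E).sum_sq_inner_left ξ).symm
    rw [hn, Finset.mul_sum, ← Finset.sum_neg_distrib, Finset.sum_mul]
    refine Finset.sum_congr rfl fun i _ => ?_
    rw [VectorFourier.fourierPowSMulRight_apply]
    simp only [Fin.prod_univ_two, Matrix.cons_val_zero, Matrix.cons_val_one, smul_eq_mul,
      Complex.real_smul, Complex.ofReal_mul, neg_mul, neg_sq, mul_pow, Complex.I_sq]
    erw [innerSL_apply_apply]
    ring
  · intro i _
    simpa using (Real.fourierIntegral_convergent_iff x).2 (hj _)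

theorem laplacian_fourierInv {w : E → ℂ} (hw : WeightedIntegrable 2 w) (x : E) :
    Δ (𝓕⁻ w) x = 𝓕⁻ (fun ξ => -((2 * Real.pi) ^ 2 * ‖ξ‖ ^ 2 : ℂ) * w ξ) x := by
  rw [Real.fourierInv_eq_fourier_comp_neg, laplacian_fourier hw.comp_neg,
    Real.fourierInv_eq_fourier_comp_neg]
  simp

theorem contDiff_fourierInv {w : E → ℂ} (hw : ∀ k, WeightedIntegrable k w) :
    ContDiff ℝ ∞ (𝓕⁻ w) := by
  rw [Real.fourierInv_eq_fourier_comp_neg]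
  exact Real.contDiff_fourier (N := ⊤) fun n _ => (hw n).comp_neg.integrable_pow_mul le_rfl

/-- Elliptic regularity: `(1 + ‖ξ‖)²` is bounded by a multiple of 1 plus the symbol of `-Δ`. -/
theorem WeightedIntegrable.add_two {k : ℕ} {w z : E → ℂ} (hw : WeightedIntegrable k w)
    (hz : WeightedIntegrable k z)
    (h : ∀ᵐ ξ, -((2 * Real.pi) ^ 2 * ‖ξ‖ ^ 2 : ℂ) * w ξ = z ξ) :
    WeightedIntegrable (k + 2) w := by
  refine ⟨hw.1, ((hw.2.add hz.2).const_mul 2).mono' ?_ ?_⟩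
  · exact (by fun_prop : Continuous fun ξ : E => (1 + ‖ξ‖) ^ (k + 2)).aestronglyMeasurable.mul
      hw.1.norm
  · filter_upwards [h] with ξ hξ
    rw [Real.norm_of_nonneg (by positivity), Pi.add_apply, ← hξ, norm_mul, norm_neg]
    have h1 : ‖((2 * Real.pi) ^ 2 * ‖ξ‖ ^ 2 : ℂ)‖ = (2 * Real.pi) ^ 2 * ‖ξ‖ ^ 2 := by
      rw [show ((2 * Real.pi) ^ 2 * ‖ξ‖ ^ 2 : ℂ) = (((2 * Real.pi) ^ 2 * ‖ξ‖ ^ 2 : ℝ) : ℂ) by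
        push_cast; rfl, Complex.norm_real, Real.norm_of_nonneg (by positivity)]
    have h2 : 1 ≤ (2 * Real.pi) ^ 2 := by nlinarith [Real.pi_gt_three]
    rw [h1, pow_add]
    have h3 : (1 + ‖ξ‖) ^ 2 ≤ 2 * (1 + (2 * Real.pi) ^ 2 * ‖ξ‖ ^ 2) := by
      nlinarith [sq_nonneg (1 - ‖ξ‖), mul_le_mul_of_nonneg_right h2 (sq_nonneg ‖ξ‖)]
    calc _ = ((1 + ‖ξ‖) ^ k * ‖w ξ‖) * (1 + ‖ξ‖) ^ 2 := by ring
      _ ≤ ((1 + ‖ξ‖) ^ k * ‖w ξ‖) * (2 * (1 + (2 * Real.pi) ^ 2 * ‖ξ‖ ^ 2)) := by gcongr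
      _ = _ := by ring

/-- Cauchy–Schwarz: `(1 + ‖ξ‖²)|w|` is dominated by `|w| + |z|` in `L²`, and `(1 + ‖ξ‖²)⁻¹` is in
`L²` exactly when the dimension is below 4. -/
theorem weightedIntegrable_zero_of_memLp_two (hE : Module.finrank ℝ E < 4) {w z : E → ℂ}
    (hw : MemLp w 2) (hz : MemLp z 2)
    (h : ∀ᵐ ξ, -((2 * Real.pi) ^ 2 * ‖ξ‖ ^ 2 : ℂ) * w ξ = z ξ) :
    WeightedIntegrable 0 w := by
  have hb : MemLp (fun ξ : E => (1 + ‖ξ‖ ^ 2)⁻¹) 2 := by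
    have hc : Continuous fun ξ : E => (1 + ‖ξ‖ ^ 2)⁻¹ :=
      Continuous.inv₀ (by fun_prop) fun ξ => by positivity
    rw [memLp_two_iff_integrable_sq hc.aestronglyMeasurable]
    have := integrable_rpow_neg_one_add_norm_sq (μ := (volume : Measure E)) (r := 4)
      (by exact_mod_cast hE)
    refine this.congr (Filter.Eventually.of_forall fun ξ => ?_)
    dsimp only
    rw [show (-4 / 2 : ℝ) = -((2 : ℕ) : ℝ) by norm_num, Real.rpow_neg (by positivity),
      Real.rpow_natCast, inv_pow]
  have hi : Integrable fun ξ => (1 + ‖ξ‖ ^ 2)⁻¹ * (‖w ξ‖ + ‖z ξ‖) :=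
    hb.integrable_mul (hw.norm.add hz.norm)
  refine ⟨hw.1, ?_⟩
  simp only [pow_zero, one_mul]
  refine hi.mono' hw.1.norm ?_
  filter_upwards [h] with ξ hξ
  have h1 : ‖((2 * Real.pi) ^ 2 * ‖ξ‖ ^ 2 : ℂ)‖ = (2 * Real.pi) ^ 2 * ‖ξ‖ ^ 2 := by
    rw [show ((2 * Real.pi) ^ 2 * ‖ξ‖ ^ 2 : ℂ) = (((2 * Real.pi) ^ 2 * ‖ξ‖ ^ 2 : ℝ) : ℂ) by
      push_cast; rfl, Complex.norm_real, Real.norm_of_nonneg (by positivity)]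
  have h2 : 1 ≤ (2 * Real.pi) ^ 2 := by nlinarith [Real.pi_gt_three]
  rw [norm_norm, ← hξ, norm_mul, norm_neg, h1, ← div_eq_inv_mul, le_div_iff₀ (by positivity)]
  nlinarith [mul_le_mul_of_nonneg_right h2 (mul_nonneg (sq_nonneg ‖ξ‖) (norm_nonneg (w ξ)))]

/-- A square-integrable function whose Fourier transform is integrable against every polynomial
weight has a smooth representative, whose Laplacian is the distributional one. -/
theorem exists_contDiff_ae_eq {u h : E → ℝ} (hu : MemLp (fun x => (u x : ℂ)) 2)
    (hh : MemLp (fun x => (h x : ℂ)) 2)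
    (hw : ∀ k, WeightedIntegrable k (𝓕 (hu.toLp _) : Lp ℂ 2 (volume : Measure E)))
    (H : ∀ᵐ ξ, -((2 * Real.pi) ^ 2 * ‖ξ‖ ^ 2 : ℂ) *
      (𝓕 (hu.toLp _) : Lp ℂ 2 (volume : Measure E)) ξ =
        (𝓕 (hh.toLp _) : Lp ℂ 2 (volume : Measure E)) ξ) :
    ∃ U : E → ℝ, ContDiff ℝ ∞ U ∧ U =ᵐ[volume] u ∧ Δ U =ᵐ[volume] h := by
  set w : E → ℂ := ((𝓕 (hu.toLp _) : Lp ℂ 2 (volume : Measure E)) : E → ℂ)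
  set z : E → ℂ := ((𝓕 (hh.toLp _) : Lp ℂ 2 (volume : Measure E)) : E → ℂ)
  have hsm := contDiff_fourierInv hw
  have hz : Integrable z := by
    refine (((hw 2).integrable_pow_mul le_rfl).const_mul ((2 * Real.pi) ^ 2)).mono'
      (Lp.aestronglyMeasurable _) ?_
    filter_upwards [H] with ξ hξ
    rw [← hξ, norm_mul, norm_neg]
    simp [mul_assoc, abs_of_pos Real.pi_pos]
  refine ⟨fun x => (𝓕⁻ w x).re, Complex.reCLM.contDiff.comp hsm, ?_, ?_⟩
  · filter_upwards [ae_eq_fourierInv_of_integrable _ (hw 0).integrable, hu.coeFn_toLp] with x h1 h2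
    rw [← h1, h2, Complex.ofReal_re]
  · filter_upwards [ae_eq_fourierInv_of_integrable _ hz, hh.coeFn_toLp] with x h1 h2
    have h3 : Δ (fun x => (𝓕⁻ w x).re) x = (Δ (𝓕⁻ w) x).re :=
      (hsm.of_le (WithTop.coe_le_coe.2
        (le_top : (2 : ℕ∞) ≤ ⊤))).contDiffAt.laplacian_CLM_comp_left (l := Complex.reCLM)
    rw [h3, laplacian_fourierInv (hw 2), Real.fourierInv_eq_fourier_neg, Real.fourier_congr_ae H,
      ← Real.fourierInv_eq_fourier_neg, ← h1, h2, Complex.ofReal_re]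

end SmoothRepresentative

/-! ### Bootstrap for the stationary system -/

section Regularity

open scoped FourierTransform

/-- The Fourier transform in `L²` of a real-valued square-integrable function. -/
noncomputable def fourierOfReal {u : Plane → ℝ} (hu : MemLp (fun x => (u x : ℂ)) 2) :
    Plane → ℂ :=
  ((𝓕 (hu.toLp _) : Lp ℂ 2 (volume : Measure Plane)) : Plane → ℂ)

theorem memLp_fourierOfReal {u : Plane → ℝ} (hu : MemLp (fun x => (u x : ℂ)) 2) :
    MemLp (fourierOfReal hu) 2 :=
  Lp.memLp _

theorem memLp_of_memLp_ofReal {u : Plane → ℝ} (hu : MemLp (fun x => (u x : ℂ)) 2) : MemLp u 2 := by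
  simpa using hu.re

theorem fourierOfReal_laplacian_eq {u h : Plane → ℝ} (hu : MemLp (fun x => (u x : ℂ)) 2)
    (hh : MemLp (fun x => (h x : ℂ)) 2)
    (H : ∀ ψ : Plane → ℝ, ContDiff ℝ ∞ ψ → HasCompactSupport ψ →
      ∫ x, Δ ψ x * u x = ∫ x, ψ x * h x) :
    ∀ᵐ ξ, -((2 * Real.pi) ^ 2 * ‖ξ‖ ^ 2 : ℂ) * fourierOfReal hu ξ = fourierOfReal hh ξ := by
  refine laplacian_fourier_ae_eq _ _ fun s => ?_
  have := integral_laplacian_schwartz_eq (memLp_of_memLp_ofReal hu) (memLp_of_memLp_ofReal hh) H s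
  calc _ = ∫ x, Δ (s : Plane → ℂ) x * u x :=
        integral_congr_ae (hu.coeFn_toLp.mono fun x hx => by simp only [hx])
    _ = ∫ x, s x * h x := this
    _ = _ := integral_congr_ae (hh.coeFn_toLp.mono fun x hx => by simp only [hx])

theorem exists_isWiener_of_weightedIntegrable {k : ℕ} {u : Plane → ℝ}
    (hu : MemLp (fun x => (u x : ℂ)) 2) (hw : WeightedIntegrable k (fourierOfReal hu)) :
    ∃ U : Plane → ℂ, IsWiener k U ∧ ∀ᵐ x, (u x : ℂ) = U x := by
  refine ⟨_, ⟨_, hw, fun x => rfl⟩, ?_⟩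
  filter_upwards [ae_eq_fourierInv_of_integrable _ hw.integrable, hu.coeFn_toLp] with x h1 h2
  rw [← h2, h1]
  rfl

theorem weightedIntegrable_of_isWiener {k : ℕ} {u : Plane → ℝ}
    (hu : MemLp (fun x => (u x : ℂ)) 2) {U : Plane → ℂ} (hU : IsWiener k U)
    (h : ∀ᵐ x, (u x : ℂ) = U x) : WeightedIntegrable k (fourierOfReal hu) := by
  obtain ⟨w, hw, hUw⟩ := hU
  refine hw.congr (fourier_ae_eq_of_ae_eq_fourierInv (hu.toLp _) hw.integrable ?_).symm
  filter_upwards [hu.coeFn_toLp, h] with x h1 h2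
  rw [h1, h2, hUw]

variable {lam q σ : ℝ} {v φ : Plane → ℝ}

/-- The right-hand side of the equation `Δv = 2σv - 2v sin(2φ)`. -/
noncomputable def rhsV (σ : ℝ) (v φ : Plane → ℝ) (x : Plane) : ℝ :=
  2 * σ * v x - 2 * v x * Real.sin (2 * φ x)

/-- The right-hand side of the equation `Δφ = λ⁻¹(q sin(2φ) - 2v² cos(2φ))`. -/
noncomputable def rhsφ (lam q : ℝ) (v φ : Plane → ℝ) (x : Plane) : ℝ :=
  lam⁻¹ * (q * Real.sin (2 * φ x) - 2 * v x ^ 2 * Real.cos (2 * φ x))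

theorem IsStationarySolution.integral_laplacian_v (hsol : IsStationarySolution lam q σ v φ)
    (ψ : Plane → ℝ) (h1 : ContDiff ℝ ∞ ψ) (h2 : HasCompactSupport ψ) :
    ∫ x, Δ ψ x * v x = ∫ x, ψ x * rhsV σ v φ x := by
  have h := hsol.v_eq ψ ⟨h1, h2⟩
  simp only [mul_neg, integral_neg] at h
  simp only [mul_comm (ψ _), mul_comm (Δ ψ _), rhsV]
  linarith

theorem IsStationarySolution.integral_laplacian_φ (hlam : 0 < lam)
    (hsol : IsStationarySolution lam q σ v φ)
    (ψ : Plane → ℝ) (h1 : ContDiff ℝ ∞ ψ) (h2 : HasCompactSupport ψ) :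
    ∫ x, Δ ψ x * φ x = ∫ x, ψ x * rhsφ lam q v φ x := by
  have h := hsol.φ_eq ψ ⟨h1, h2⟩
  simp only [mul_neg, integral_neg, sq_abs] at h
  simp only [mul_comm (ψ _), mul_comm (Δ ψ _), rhsφ, mul_assoc lam⁻¹]
  rw [integral_const_mul, eq_inv_mul_iff_mul_eq₀ hlam.ne']
  linarith

theorem isWiener_rhsV {k : ℕ} {V Φ : Plane → ℂ} (hV : IsWiener k V) (hΦ : IsWiener k Φ) :
    IsWiener k fun x => 2 * σ * V x - 2 * V x * Complex.sin (2 * Φ x) :=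
  ((hV.const_mul (2 * σ)).add ((hV.mul (hΦ.const_mul 2).csin).const_mul (-2))).congr
    fun x => by ring

/-- Write `V² cos = V² + V²(cos - 1)`, since the cosine alone has a constant term. -/
theorem isWiener_rhsφ {k : ℕ} {V Φ : Plane → ℂ} (hV : IsWiener k V) (hΦ : IsWiener k Φ) :
    IsWiener k fun x => (lam : ℂ)⁻¹ *
      (q * Complex.sin (2 * Φ x) - 2 * V x ^ 2 * Complex.cos (2 * Φ x)) :=
  ((((hΦ.const_mul 2).csin.const_mul q).add
    (((hV.mul hV).add ((hV.mul hV).mul (hΦ.const_mul 2).ccos_sub_one)).const_mul (-2))).const_mul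
      (lam : ℂ)⁻¹).congr fun x => by ring

theorem memLp_two_of_abs_le {u w : Plane → ℝ} (hu : MemLp u 2) (hw : AEStronglyMeasurable w volume)
    {C : ℝ} (h : ∀ᵐ x, |w x| ≤ C * |u x|) : MemLp (fun x => (w x : ℂ)) 2 :=
  (hu.of_le_mul hw h).ofReal

theorem memLp_rhsV (hv : MemLp v 2) (hφ : MemLp φ 2) :
    MemLp (fun x => (rhsV σ v φ x : ℂ)) 2 := by
  refine memLp_two_of_abs_le hv ?_ (C := 2 * |σ| + 2) (Filter.Eventually.of_forall fun x => ?_)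
  · exact (hv.1.const_mul _).sub ((hv.1.const_mul 2).mul
      (Real.continuous_sin.comp_aestronglyMeasurable (hφ.1.const_mul 2)))
  · calc |rhsV σ v φ x| ≤ |2 * σ * v x| + |2 * v x * Real.sin (2 * φ x)| := abs_sub _ _
      _ = 2 * |σ| * |v x| + 2 * |v x| * |Real.sin (2 * φ x)| := by simp [abs_mul]
      _ ≤ 2 * |σ| * |v x| + 2 * |v x| * 1 := by gcongr; exact Real.abs_sin_le_one _
      _ = _ := by ring

/-- Boundedness of `v` is needed to put `v²` in `L²`; hence the equation for `v` is exploited before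
that for `φ`. -/
theorem memLp_rhsφ (hv : MemLp v 2) (hφ : MemLp φ 2) {C : ℝ} (hC : ∀ᵐ x, |v x| ≤ C) :
    MemLp (fun x => (rhsφ lam q v φ x : ℂ)) 2 := by
  have hv2 : MemLp (fun x => v x ^ 2) 2 := by
    refine hv.of_le_mul (hv.1.pow 2) (c := C) ?_
    filter_upwards [hC] with x hx
    rw [norm_pow, sq]
    gcongr
    exact hx
  have hs : AEStronglyMeasurable (fun x => Real.sin (2 * φ x)) volume :=
    Real.continuous_sin.comp_aestronglyMeasurable (hφ.1.const_mul 2)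
  have hc : AEStronglyMeasurable (fun x => Real.cos (2 * φ x)) volume :=
    Real.continuous_cos.comp_aestronglyMeasurable (hφ.1.const_mul 2)
  have h1 : MemLp (fun x => Real.sin (2 * φ x)) 2 := by
    refine hφ.of_le_mul hs (c := 2) (Filter.Eventually.of_forall fun x => ?_)
    rw [Real.norm_eq_abs, Real.norm_eq_abs]
    calc _ ≤ |2 * φ x| := Real.abs_sin_le_abs
      _ = _ := by simp [abs_mul]
  have h2 : MemLp (fun x => v x ^ 2 * Real.cos (2 * φ x)) 2 := by
    refine hv2.of_le_mul (hv2.1.mul hc) (c := 1) (Filter.Eventually.of_forall fun x => ?_)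
    rw [norm_mul, one_mul]
    exact mul_le_of_le_one_right (norm_nonneg _) (Real.abs_cos_le_one _)
  have := ((h1.const_mul q).sub (h2.const_mul 2)).const_mul lam⁻¹
  convert this.ofReal (K := ℂ) using 2 with x
  simp only [rhsφ, Pi.sub_apply, mul_assoc]
  rfl

/-- The Fourier transforms of a stationary solution are integrable against every polynomial
weight. -/
theorem IsStationarySolution.weightedIntegrable (hlam : 0 < lam)
    (hsol : IsStationarySolution lam q σ v φ) (hv : MemLp (fun x => (v x : ℂ)) 2)
    (hφ : MemLp (fun x => (φ x : ℂ)) 2) :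
    MemLp (fun x => (rhsφ lam q v φ x : ℂ)) 2 ∧
      ∀ k, WeightedIntegrable k (fourierOfReal hv) ∧ WeightedIntegrable k (fourierOfReal hφ) := by
  have hv' := memLp_of_memLp_ofReal hv
  have hφ' := memLp_of_memLp_ofReal hφ
  have hHv : MemLp (fun x => (rhsV σ v φ x : ℂ)) 2 := memLp_rhsV hv' hφ'
  have hd : Module.finrank ℝ Plane < 4 := by simp
  have hLv := fourierOfReal_laplacian_eq hv hHv hsol.integral_laplacian_v
  have hv0 : WeightedIntegrable 0 (fourierOfReal hv) :=
    weightedIntegrable_zero_of_memLp_two hd (memLp_fourierOfReal hv) (memLp_fourierOfReal hHv) hLv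
  -- The supremum of `|v|` is at most the `L¹` norm of its transform.
  have hbdd : ∃ C, ∀ᵐ x, |v x| ≤ C := by
    obtain ⟨U, ⟨w, hw, hU⟩, h⟩ := exists_isWiener_of_weightedIntegrable hv hv0
    refine ⟨∫ ξ, ‖w ξ‖, h.mono fun x hx => ?_⟩
    rw [← Real.norm_eq_abs, ← Complex.norm_real, hx, hU, Real.fourierInv_eq]
    refine (norm_integral_le_integral_norm _).trans_eq ?_
    simp
  obtain ⟨C, hC⟩ := hbdd
  have hHφ : MemLp (fun x => (rhsφ lam q v φ x : ℂ)) 2 := memLp_rhsφ hv' hφ' hC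
  have hLφ := fourierOfReal_laplacian_eq hφ hHφ (hsol.integral_laplacian_φ hlam)
  have hφ0 : WeightedIntegrable 0 (fourierOfReal hφ) :=
    weightedIntegrable_zero_of_memLp_two hd (memLp_fourierOfReal hφ) (memLp_fourierOfReal hHφ) hLφ
  refine ⟨hHφ, fun k => ?_⟩
  induction k with
  | zero => exact ⟨hv0, hφ0⟩
  | succ k ih =>
    obtain ⟨V, hV, hVe⟩ := exists_isWiener_of_weightedIntegrable hv ih.1
    obtain ⟨Φ, hΦ, hΦe⟩ := exists_isWiener_of_weightedIntegrable hφ ih.2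
    have h1 := weightedIntegrable_of_isWiener hHv (isWiener_rhsV (σ := σ) hV hΦ) (by
      filter_upwards [hVe, hΦe] with x h1 h2
      rw [← h1, ← h2, rhsV]
      push_cast
      rfl)
    have h2 := weightedIntegrable_of_isWiener hHφ (isWiener_rhsφ (lam := lam) (q := q) hV hΦ) (by
      filter_upwards [hVe, hΦe] with x h1 h2
      rw [← h1, ← h2, rhsφ]
      push_cast
      rfl)
    -- Two powers are gained, but one suffices for the induction.
    exact ⟨(ih.1.add_two h1 hLv).mono (Nat.le_succ _), (ih.2.add_two h2 hLφ).mono (Nat.le_succ _)⟩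

/-- The equations hold almost everywhere for the smooth representatives; both sides are continuous,
so they hold everywhere. -/
theorem IsStationarySolution.exists_classical (hlam : 0 < lam)
    (hsol : IsStationarySolution lam q σ v φ) :
    ∃ V Φ : Plane → ℝ, ContDiff ℝ ∞ V ∧ ContDiff ℝ ∞ Φ ∧ V =ᵐ[volume] v ∧ Φ =ᵐ[volume] φ ∧
      (∀ x, Δ V x = rhsV σ V Φ x) ∧ ∀ x, Δ Φ x = rhsφ lam q V Φ x := by
  obtain ⟨hv, -⟩ := hsol.v_mem
  obtain ⟨hφ, -⟩ := hsol.φ_mem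
  obtain ⟨hHφ, hw⟩ := hsol.weightedIntegrable hlam hv hφ
  have hHv : MemLp (fun x => (rhsV σ v φ x : ℂ)) 2 :=
    memLp_rhsV (memLp_of_memLp_ofReal hv) (memLp_of_memLp_ofReal hφ)
  obtain ⟨V, hV, hVe, hVL⟩ := exists_contDiff_ae_eq hv hHv (fun k => (hw k).1)
    (fourierOfReal_laplacian_eq hv hHv hsol.integral_laplacian_v)
  obtain ⟨Φ, hΦ, hΦe, hΦL⟩ := exists_contDiff_ae_eq hφ hHφ (fun k => (hw k).2)
    (fourierOfReal_laplacian_eq hφ hHφ (hsol.integral_laplacian_φ hlam))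
  have h2 : (2 : WithTop ℕ∞) ≤ ∞ := WithTop.coe_le_coe.2 (le_top : (2 : ℕ∞) ≤ ⊤)
  refine ⟨V, Φ, hV, hΦ, hVe, hΦe, fun x => ?_, fun x => ?_⟩
  · refine congrFun ((Continuous.ae_eq_iff_eq volume (hV.of_le h2).continuous_laplacian ?_).1 ?_) x
    · have := hV.continuous
      have := hΦ.continuous
      unfold rhsV
      fun_prop
    · filter_upwards [hVe, hΦe, hVL] with x h1 h2 h3
      rw [h3, rhsV, rhsV, h1, h2]
  · refine congrFun ((Continuous.ae_eq_iff_eq volume (hΦ.of_le h2).continuous_laplacian ?_).1 ?_) x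
    · have := hV.continuous
      have := hΦ.continuous
      unfold rhsφ
      fun_prop
    · filter_upwards [hVe, hΦe, hΦL] with x h1 h2 h3
      rw [h3, rhsφ, rhsφ, h1, h2]

/-- A real-valued function in `L¹ ∩ L²` whose Fourier transform is integrable against every
polynomial weight belongs to every `H^k`. -/
theorem memH_of_integrable {u : Plane → ℝ} (hu : MemLp (fun x => (u x : ℂ)) 2)
    (hi : Integrable u) (hw : ∀ k, WeightedIntegrable k (fourierOfReal hu)) (k : ℕ) :
    MemH k u := by
  refine ⟨hu, ?_⟩
  rw [TemperedDistribution.memSobolev_iff_exists_smulLeftCLM_fourier]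
  -- With a bounded transform, `|û|² ≤ C|û|`, so the `L²` weight of order `k` reduces to the `L¹`
  -- weight of order `2k`.
  have hbd : ∃ C, ∀ᵐ ξ, ‖fourierOfReal hu ξ‖ ≤ C := by
    have hi' : Integrable (hu.toLp _) := hi.ofReal.congr hu.coeFn_toLp.symm
    refine ⟨∫ x, ‖hu.toLp _ x‖, ?_⟩
    filter_upwards [fourier_ae_eq_fourier_of_integrable _ hi'] with ξ hξ
    rw [fourierOfReal, hξ, Real.fourier_eq]
    refine (norm_integral_le_integral_norm _).trans_eq ?_
    simp
  obtain ⟨C, hC⟩ := hbd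
  have hg : (fun ξ : Plane => (((1 + ‖ξ‖ ^ 2) ^ ((k : ℝ) / 2) : ℝ) : ℂ)).HasTemperateGrowth := by
    fun_prop
  have hmem : MemLp (fun ξ => (((1 + ‖ξ‖ ^ 2) ^ ((k : ℝ) / 2) : ℝ) : ℂ) * fourierOfReal hu ξ) 2 := by
    have hm : AEStronglyMeasurable
        (fun ξ => (((1 + ‖ξ‖ ^ 2) ^ ((k : ℝ) / 2) : ℝ) : ℂ) * fourierOfReal hu ξ) volume :=
      hg.1.continuous.aestronglyMeasurable.mul (hw 0).1
    rw [memLp_two_iff_integrable_sq_norm hm]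
    refine ((hw (2 * k)).2.const_mul C).mono' (hm.norm.pow 2) ?_
    filter_upwards [hC] with ξ hξ
    have h1 : ((1 + ‖ξ‖ ^ 2) ^ ((k : ℝ) / 2)) ^ 2 ≤ (1 + ‖ξ‖) ^ (2 * k) := by
      rw [← Real.rpow_natCast, ← Real.rpow_mul (by positivity)]
      rw [show (k : ℝ) / 2 * ((2 : ℕ) : ℝ) = (k : ℝ) by push_cast; ring, Real.rpow_natCast, pow_mul]
      gcongr
      nlinarith [norm_nonneg ξ]
    rw [Real.norm_of_nonneg (by positivity), norm_mul, Complex.norm_real,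
      Real.norm_of_nonneg (by positivity), mul_pow, sq ‖fourierOfReal hu ξ‖]
    calc _ ≤ (1 + ‖ξ‖) ^ (2 * k) * (C * ‖fourierOfReal hu ξ‖) := by gcongr
      _ = _ := by ring
  refine ⟨hmem.toLp _, ?_⟩
  rw [Lp.fourier_toTemperedDistribution_eq]
  ext s
  rw [TemperedDistribution.smulLeftCLM_apply_apply, Lp.toTemperedDistribution_apply,
    Lp.toTemperedDistribution_apply]
  refine integral_congr_ae ?_
  filter_upwards [hmem.coeFn_toLp] with ξ hξ
  rw [hξ, SchwartzMap.smulLeftCLM_apply_apply hg]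
  simp only [smul_eq_mul, fourierOfReal]
  ring

end Regularity

/-! ### Differential inequalities on a half-line -/

section RadialODE

open Filter Set Topology

theorem antitoneOn_Ioi_of_hasDerivAt_nonpos {F F' : ℝ → ℝ} {R : ℝ}
    (h : ∀ r, R < r → HasDerivAt F (F' r) r) (h' : ∀ r, R < r → F' r ≤ 0) :
    AntitoneOn F (Ioi R) := by
  refine antitoneOn_of_deriv_nonpos (convex_Ioi R)
    (fun r hr => (h r hr).continuousAt.continuousWithinAt) ?_ ?_
  · rw [interior_Ioi]
    exact fun r hr => (h r hr).differentiableAt.differentiableWithinAt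
  · rw [interior_Ioi]
    exact fun r hr => (h r hr).deriv ▸ h' r hr

theorem AntitoneOn.hasDerivAt_nonpos {F : ℝ → ℝ} {F' R r : ℝ} (hF : AntitoneOn F (Ioi R))
    (hr : R < r) (h : HasDerivAt F F' r) : F' ≤ 0 := by
  have := hF.derivWithin_nonpos (x := r)
  rwa [derivWithin_of_isOpen isOpen_Ioi hr, h.deriv] at this

/-- A decreasing and vanishing solution of `Q'' ≥ μ² Q` decays like `e^{-μr}`. -/
theorem le_exp_of_deriv_two_ge {Q Q₁ Q₂ : ℝ → ℝ} {μ R : ℝ}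
    (h1 : ∀ r, R < r → HasDerivAt Q (Q₁ r) r) (h2 : ∀ r, R < r → HasDerivAt Q₁ (Q₂ r) r)
    (hQ₁ : ∀ r, R < r → Q₁ r ≤ 0)
    (hQ₂ : ∀ r, R < r → μ ^ 2 * Q r ≤ Q₂ r) (hlim : Tendsto Q atTop (𝓝 0)) :
    ∃ C, ∀ r, R + 1 < r → Q r ≤ C * Real.exp (-μ * r) := by
  -- The energy has derivative `2Q'(Q'' - μ²Q) ≤ 0`. Being bounded below by `-μ²Q² → 0`, it is
  -- nonnegative, which with `Q' ≤ 0` gives `Q' ≤ -μQ`.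
  have hE : AntitoneOn (fun r => Q₁ r ^ 2 - μ ^ 2 * Q r ^ 2) (Ioi R) := by
    refine antitoneOn_Ioi_of_hasDerivAt_nonpos
      (F' := fun r => 2 * Q₁ r * Q₂ r - μ ^ 2 * (2 * Q r * Q₁ r)) (fun r hr => ?_) fun r hr => ?_
    · simpa using! ((h2 r hr).fun_pow 2).sub (((h1 r hr).fun_pow 2).const_mul (μ ^ 2))
    · nlinarith [mul_nonneg (neg_nonneg.2 (hQ₁ r hr)) (sub_nonneg.2 (hQ₂ r hr))]
  have hE0 (r : ℝ) (hr : R < r) : 0 ≤ Q₁ r ^ 2 - μ ^ 2 * Q r ^ 2 := by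
    have hl : Tendsto (fun s => -(μ ^ 2 * Q s ^ 2)) atTop (𝓝 0) := by
      simpa using ((hlim.pow 2).const_mul (μ ^ 2)).neg
    refine le_of_tendsto hl ?_
    filter_upwards [eventually_ge_atTop r] with s hs
    have := hE hr (lt_of_lt_of_le hr hs) hs
    dsimp only at this
    nlinarith [sq_nonneg (Q₁ s)]
  have hle (r : ℝ) (hr : R < r) : Q₁ r + μ * Q r ≤ 0 := by
    have h3 : (μ * Q r) ^ 2 ≤ (-Q₁ r) ^ 2 := by nlinarith [hE0 r hr]
    have := abs_le_of_sq_le_sq h3 (neg_nonneg.2 (hQ₁ r hr))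
    linarith [(le_abs_self _).trans this]
  have hA : AntitoneOn (fun r => Q r * Real.exp (μ * r)) (Ioi R) := by
    refine antitoneOn_Ioi_of_hasDerivAt_nonpos
      (F' := fun r => Q₁ r * Real.exp (μ * r) + Q r * (Real.exp (μ * r) * μ))
      (fun r hr => ?_) fun r hr => ?_
    · exact (h1 r hr).mul (by simpa using ((hasDerivAt_id r).const_mul μ).exp)
    · nlinarith [mul_nonneg (neg_nonneg.2 (hle r hr)) (Real.exp_pos (μ * r)).le]
  refine ⟨Q (R + 1) * Real.exp (μ * (R + 1)), fun r hr => ?_⟩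
  have := hA (mem_Ioi.2 (lt_add_one R)) (mem_Ioi.2 (by linarith : R < r)) hr.le
  rw [neg_mul, Real.exp_neg, ← div_eq_mul_inv, le_div_iff₀ (Real.exp_pos _)]
  exact this

/-- A decreasing, vanishing, nonnegative radial function on the plane that is superharmonic outside
a disk vanishes there. -/
theorem eq_zero_of_radial_superharmonic {p p₁ p₂ : ℝ → ℝ} {R : ℝ} (hR : 0 < R)
    (h1 : ∀ r, R < r → HasDerivAt p (p₁ r) r) (h2 : ∀ r, R < r → HasDerivAt p₁ (p₂ r) r)
    (hp : ∀ r, R < r → 0 ≤ p r) (hp₁ : ∀ r, R < r → p₁ r ≤ 0)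
    (hp₂ : ∀ r, R < r → p₂ r + p₁ r / r ≤ 0) (hlim : Tendsto p atTop (𝓝 0))
    {r : ℝ} (hr : R < r) : p r = 0 := by
  -- The derivative of `r p'` is `r(p'' + p'/r)`.
  have hA : AntitoneOn (fun r => r * p₁ r) (Ioi R) := by
    refine antitoneOn_Ioi_of_hasDerivAt_nonpos (F' := fun r => 1 * p₁ r + r * p₂ r)
      (fun r hr => (hasDerivAt_id r).mul (h2 r hr)) fun r hr => ?_
    have hr0 : 0 < r := hR.trans hr
    have := mul_nonpos_of_nonneg_of_nonpos hr0.le (hp₂ r hr)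
    rw [mul_add, mul_div_cancel₀ _ hr0.ne'] at this
    linarith
  have hzero (s : ℝ) (hs : R < s) : p₁ s = 0 := by
    by_contra hne
    have hneg : p₁ s < 0 := lt_of_le_of_ne (hp₁ s hs) hne
    have hs0 : 0 < s := hR.trans hs
    set c := -(s * p₁ s)
    have hc : 0 < c := by simp only [c]; nlinarith
    -- If `p'` were negative at `s`, then `p' ≤ -c/r` afterwards, and the divergence of the
    -- logarithm would drive `p` below zero.
    have hB : AntitoneOn (fun r => p r + c * Real.log r) (Ioi s) := by
      refine antitoneOn_Ioi_of_hasDerivAt_nonpos (F' := fun r => p₁ r + c * r⁻¹)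
        (fun r hr => (h1 r (hs.trans hr)).add
          ((Real.hasDerivAt_log (hs0.trans hr).ne').const_mul c)) fun r hr => ?_
      have h3 : r * p₁ r ≤ s * p₁ s := hA hs (hs.trans hr : R < r) hr.le
      have hr0 : 0 < r := hs0.trans hr
      have : p₁ r + c * r⁻¹ = (r * p₁ r + c) / r := by field_simp
      rw [this]
      exact div_nonpos_of_nonpos_of_nonneg (by simp only [c]; linarith) hr0.le
    have hlog : Tendsto (fun r => c * Real.log r) atTop atTop :=
      Real.tendsto_log_atTop.const_mul_atTop hc
    obtain ⟨r, hr1, hr2⟩ := ((hlog.eventually_gt_atTop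
      (p (s + 1) + c * Real.log (s + 1))).and (eventually_gt_atTop (s + 1))).exists
    have h4 := hB (mem_Ioi.2 (lt_add_one s)) (mem_Ioi.2 ((lt_add_one s).trans hr2)) hr2.le
    have h5 := hp r (by linarith)
    dsimp only at h4
    linarith
  refine le_antisymm ?_ (hp r hr)
  have hM : AntitoneOn (fun r => -p r) (Ioi R) :=
    antitoneOn_Ioi_of_hasDerivAt_nonpos (F' := fun r => -p₁ r) (fun r hr => (h1 r hr).neg)
      fun r hr => by rw [hzero r hr, neg_zero]
  refine ge_of_tendsto hlim ?_
  filter_upwards [eventually_ge_atTop r] with s hs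
  have := hM hr (lt_of_lt_of_le hr hs) hs
  dsimp only at this
  linarith

end RadialODE

/-! ### Monotone profiles and polar coordinates -/

section RadialProfile

open Filter Set Topology

namespace IsDecreasingProfile

variable {u : Plane → ℝ} {f : ℝ → ℝ}

theorem nonneg_and_tendsto (hf : IsDecreasingProfile u f) (hu : MemLp u 2) :
    (∀ r, 0 < r → 0 ≤ f r) ∧ Tendsto f atTop (𝓝 0) := by
  have hfin (ε : ℝ) (hε : 0 < ε) : volume {x | ε ≤ |u x|} < ⊤ := by
    have := hu.meas_ge_lt_top' (by norm_num) (by norm_num) (ε := ENNReal.ofReal ε) (by simpa)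
    refine lt_of_le_of_lt (measure_mono fun x (hx : ε ≤ |u x|) => ?_) this
    change ENNReal.ofReal ε ≤ ‖u x‖ₑ
    rw [Real.enorm_eq_ofReal_abs]
    exact ENNReal.ofReal_le_ofReal hx
  -- Otherwise `|u| ≥ ε` off a ball, a set of infinite measure, against Chebyshev's inequality.
  have key (ε R : ℝ) (hε : 0 < ε) (h : ∀ r, R < r → ε ≤ |f r|) : False := by
    have h1 : volume (Metric.closedBall (0 : Plane) R)ᶜ ≤ volume {x | ε ≤ |u x|} := by
      refine measure_mono_ae ?_
      filter_upwards [hf.ae_eq] with x hx hxR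
      change ε ≤ |u x|
      rw [hx]
      exact h _ (not_le.1 fun hle => hxR (mem_closedBall_zero_iff.2 hle))
    have h2 : volume (Metric.closedBall (0 : Plane) R) < ⊤ := measure_closedBall_lt_top
    have h3 := measure_univ_le_add_compl (μ := (volume : Measure Plane))
      (Metric.closedBall (0 : Plane) R)
    have h4 : volume (univ : Set Plane) = ⊤ := measure_univ_of_isAddLeftInvariant _
    rw [h4] at h3
    exact absurd h3 (not_le.2 (ENNReal.add_lt_top.2 ⟨h2, h1.trans_lt (hfin ε hε)⟩))
  have hnn (r : ℝ) (hr : 0 < r) : 0 ≤ f r := by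
    by_contra! hneg
    refine key (-f r) r (by linarith) fun s hs => ?_
    have := hf.antitoneOn hr (hr.trans hs) hs.le
    rw [abs_of_nonpos (by linarith)]
    linarith
  refine ⟨hnn, ?_⟩
  rw [Metric.tendsto_atTop]
  intro ε hε
  by_contra! hcon
  refine key ε 0 hε fun r hr => ?_
  obtain ⟨s, hs, hs'⟩ := hcon r
  rw [Real.dist_0_eq_abs, abs_of_nonneg (hnn s (hr.trans_le hs))] at hs'
  rw [abs_of_nonneg (hnn r hr)]
  exact hs'.trans (hf.antitoneOn hr (hr.trans_le hs) hs)

/-- A jump of `f` is impossible: a strict inequality at `x` persists nearby, and on a suitable side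
of the sphere through `x` it contradicts monotonicity at points where the almost everywhere identity
holds. -/
theorem eq_of_continuous (hf : IsDecreasingProfile u f) (hu : Continuous u) {x : Plane}
    (hx : x ≠ 0) : u x = f ‖x‖ := by
  have hx0 : 0 < ‖x‖ := norm_pos_iff.2 hx
  have hex (N M : Set Plane) (hN : IsOpen N) (hM : IsOpen M) (hxN : x ∈ N)
      (hfreq : ∃ᶠ y in 𝓝 x, y ∈ M) : ∃ y ∈ N ∩ M, u y = f ‖y‖ := by
    obtain ⟨y, hy⟩ := (hfreq.and_eventually (hN.mem_nhds hxN)).exists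
    have hpos : 0 < volume (N ∩ M) := (hN.inter hM).measure_pos _ ⟨y, hy.2, hy.1⟩
    obtain ⟨z, hz⟩ := ((frequently_ae_mem_iff.2 hpos.ne').and_eventually hf.ae_eq).exists
    exact ⟨z, hz⟩
  have hscale : Tendsto (fun t : ℝ => t • x) (𝓝 1) (𝓝 x) := by
    have : Continuous fun t : ℝ => t • x := by fun_prop
    simpa using this.tendsto 1
  apply le_antisymm
  · by_contra! hlt
    obtain ⟨y, ⟨hy1, hy2⟩, hy3⟩ := hex {y | f ‖x‖ < u y} {y | ‖x‖ < ‖y‖}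
      (isOpen_lt continuous_const hu) (isOpen_lt continuous_const continuous_norm) hlt (by
        refine (hscale.mono_left (nhdsWithin_le_nhds (s := Ioi 1))).frequently
          (Eventually.frequently ?_)
        filter_upwards [self_mem_nhdsWithin] with t (ht : 1 < t)
        rw [norm_smul, Real.norm_of_nonneg (by linarith)]
        nlinarith)
    have := hf.antitoneOn hx0 (hx0.trans hy2) (le_of_lt hy2)
    exact absurd (hy3 ▸ hy1 : f ‖x‖ < f ‖y‖) (not_lt.2 this)
  · by_contra! hlt
    obtain ⟨y, ⟨⟨hy1, hy4⟩, hy2⟩, hy3⟩ := hex {y | u y < f ‖x‖ ∧ y ≠ 0} {y | ‖y‖ < ‖x‖}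
      ((isOpen_lt hu continuous_const).inter isOpen_ne)
      (isOpen_lt continuous_norm continuous_const) ⟨hlt, hx⟩ (by
        refine (hscale.mono_left (nhdsWithin_le_nhds (s := Iio 1))).frequently
          (Eventually.frequently ?_)
        filter_upwards [self_mem_nhdsWithin,
          nhdsWithin_le_nhds (lt_mem_nhds (zero_lt_one (α := ℝ)))] with t (ht : t < 1) ht0
        rw [norm_smul, Real.norm_of_nonneg ht0.le]
        nlinarith)
    have := hf.antitoneOn (norm_pos_iff.2 hy4) hx0 (le_of_lt hy2)
    rw [hy3] at hy1
    linarith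

end IsDecreasingProfile

theorem laplacian_plane (U : Plane → ℝ) (x : Plane) :
    Δ U x = fderiv ℝ (fderiv ℝ U) x (EuclideanSpace.single 0 1) (EuclideanSpace.single 0 1) +
      fderiv ℝ (fderiv ℝ U) x (EuclideanSpace.single 1 1) (EuclideanSpace.single 1 1) := by
  rw [InnerProductSpace.laplacian_eq_iteratedFDeriv_orthonormalBasis U
    (EuclideanSpace.basisFun (Fin 2) ℝ)]
  simp [Fin.sum_univ_two, iteratedFDeriv_two_apply]

theorem hasDerivAt_comp_line {F : Type*} [NormedAddCommGroup F] [NormedSpace ℝ F] {U : Plane → F}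
    (hU : Differentiable ℝ U) (x e : Plane) (t : ℝ) :
    HasDerivAt (fun s : ℝ => U (x + s • e)) (fderiv ℝ U (x + t • e) e) t := by
  have h : HasDerivAt (fun s : ℝ => x + s • e) e t := by
    simpa using ((hasDerivAt_id t).smul_const e).const_add x
  exact (hU (x + t • e)).hasFDerivAt.comp_hasDerivAt t h

/-- The Laplacian of a radial function in polar coordinates. -/
theorem exists_radial_derivatives {U : Plane → ℝ} {f : ℝ → ℝ} (hU : ContDiff ℝ 2 U)
    (hf : ∀ x, x ≠ 0 → U x = f ‖x‖) :
    ∃ f₁ f₂ : ℝ → ℝ, ∀ r, 0 < r → HasDerivAt f (f₁ r) r ∧ HasDerivAt f₁ (f₂ r) r ∧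
      Δ U (EuclideanSpace.single 0 r) = f₂ r + f₁ r / r := by
  set e₀ : Plane := EuclideanSpace.single 0 1
  set e₁ : Plane := EuclideanSpace.single 1 1
  have hU1 : Differentiable ℝ U := hU.differentiable (by norm_num)
  have hU2 : ContDiff ℝ 1 (fderiv ℝ U) := hU.fderiv_right (by norm_num)
  have hU2' : Differentiable ℝ (fderiv ℝ U) := hU2.differentiable (by norm_num)
  have hnorm (r t : ℝ) : ‖r • e₀ + t • e₁‖ = √(r ^ 2 + t ^ 2) := by
    simp [EuclideanSpace.norm_eq, Fin.sum_univ_two, e₀, e₁]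
  have hne (r t : ℝ) (hr : 0 < r) : r • e₀ + t • e₁ ≠ 0 := by
    rw [← norm_pos_iff, hnorm]
    positivity
  have hfe (r : ℝ) (hr : 0 < r) : f r = U (r • e₀) := by
    have h1 := hf _ (hne r 0 hr)
    rw [hnorm] at h1
    simpa [Real.sqrt_sq hr.le] using h1.symm
  have hline {F : Type} [NormedAddCommGroup F] [NormedSpace ℝ F] {W : Plane → F}
      (hW : Differentiable ℝ W) (r : ℝ) :
      HasDerivAt (fun s : ℝ => W (s • e₀)) (fderiv ℝ W (r • e₀) e₀) r := by
    simpa using hasDerivAt_comp_line hW 0 e₀ r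
  have hd1 (r : ℝ) (hr : 0 < r) : HasDerivAt f (fderiv ℝ U (r • e₀) e₀) r := by
    refine (hline hU1 r).congr_of_eventuallyEq ?_
    filter_upwards [lt_mem_nhds hr] with s hs using hfe s hs
  refine ⟨fun r => fderiv ℝ U (r • e₀) e₀, fun r => fderiv ℝ (fderiv ℝ U) (r • e₀) e₀ e₀,
    fun r hr => ⟨hd1 r hr, ?_, ?_⟩⟩
  · exact (ContinuousLinearMap.apply ℝ ℝ e₀).hasFDerivAt.comp_hasDerivAt r (hline hU2' r)
  · have hx : (EuclideanSpace.single 0 r : Plane) = r • e₀ := by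
      ext i
      fin_cases i <;> simp [e₀]
    rw [hx, laplacian_plane]
    congr 1
    -- Along the tangent line `U = f ∘ ρ`, with derivative `f'(ρ) t/ρ = t k(t)`. Its derivative at 0
    -- is `k 0 = f'(r)/r`, for which continuity of `k` is enough.
    set ρ : ℝ → ℝ := fun t => √(r ^ 2 + t ^ 2)
    have hρpos (t : ℝ) : 0 < ρ t := by positivity
    have hρ (t : ℝ) : HasDerivAt ρ (t / ρ t) t := by
      have h1 : HasDerivAt (fun t : ℝ => r ^ 2 + t ^ 2) (2 * t) t := by
        simpa using (hasDerivAt_pow 2 t).const_add (r ^ 2)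
      convert h1.sqrt (by positivity) using 1
      change t / ρ t = 2 * t / (2 * ρ t)
      rw [mul_div_mul_left _ _ two_ne_zero]
    have hfirst (t : ℝ) : fderiv ℝ U (r • e₀ + t • e₁) e₁ =
        fderiv ℝ U (ρ t • e₀) e₀ * (t / ρ t) := by
      have h1 := hasDerivAt_comp_line hU1 (r • e₀) e₁ t
      have h2 := (hd1 (ρ t) (hρpos t)).comp t (hρ t)
      refine h1.unique (h2.congr_of_eventuallyEq (Eventually.of_forall fun s => ?_))
      change U (r • e₀ + s • e₁) = f (ρ s)
      rw [hf _ (hne r s hr), hnorm]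
    have hsecond : HasDerivAt (fun t : ℝ => fderiv ℝ U (r • e₀ + t • e₁) e₁)
        (fderiv ℝ (fderiv ℝ U) (r • e₀ + (0 : ℝ) • e₁) e₁ e₁) 0 :=
      (ContinuousLinearMap.apply ℝ ℝ e₁).hasFDerivAt.comp_hasDerivAt 0
        (hasDerivAt_comp_line hU2' (r • e₀) e₁ 0)
    set k : ℝ → ℝ := fun t => fderiv ℝ U (ρ t • e₀) e₀ / ρ t
    have hk : ContinuousAt k 0 := by
      have h1 : Continuous ρ := continuous_iff_continuousAt.2 fun t => (hρ t).continuousAt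
      have h2 : Continuous fun t => fderiv ℝ U (ρ t • e₀) e₀ :=
        (hU2.continuous.comp (h1.smul continuous_const)).clm_apply continuous_const
      exact (h2.div h1 fun t => (hρpos t).ne').continuousAt
    have hprod : HasDerivAt (fun t => t * k t) (k 0) 0 := by
      rw [hasDerivAt_iff_tendsto_slope]
      refine (hk.tendsto.mono_left nhdsWithin_le_nhds).congr' ?_
      filter_upwards [self_mem_nhdsWithin] with t ht
      have : t ≠ 0 := ht
      simp [slope_def_field, this]
    have heq : (fun t => fderiv ℝ U (r • e₀ + t • e₁) e₁) = fun t => t * k t := by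
      ext t
      rw [hfirst]
      simp only [k]
      ring
    rw [heq] at hsecond
    have := hsecond.unique hprod
    simpa [k, ρ, Real.sqrt_sq hr.le] using this

end RadialProfile

/-! ### Exponential decay of the profiles -/

section Decay

open Filter Set Topology

/-- The profile of the first component of a stationary solution decays exponentially. -/
theorem exists_exp_decay_v {σ : ℝ} {f f₁ f₂ g : ℝ → ℝ}
    (h1 : ∀ r, 0 < r → HasDerivAt f (f₁ r) r) (h2 : ∀ r, 0 < r → HasDerivAt f₁ (f₂ r) r)
    (hf : ∀ r, 0 < r → 0 ≤ f r) (hf₁ : ∀ r, 0 < r → f₁ r ≤ 0) (hf0 : Tendsto f atTop (𝓝 0))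
    (hg : ∀ r, 0 < r → 0 ≤ g r) (hg0 : Tendsto g atTop (𝓝 0))
    (heq : ∀ r, 0 < r → f₂ r + f₁ r / r = 2 * σ * f r - 2 * f r * Real.sin (2 * g r)) :
    ∃ m R C : ℝ, 0 < m ∧ 0 < R ∧ ∀ r, R < r → f r ≤ C * Real.exp (-m * r) := by
  rcases lt_or_ge 0 σ with hσ | hσ
  · have hs : Tendsto (fun r => Real.sin (2 * g r)) atTop (𝓝 0) := by
      have := (Real.continuous_sin.tendsto (2 * 0)).comp (hg0.const_mul 2)
      simpa [Function.comp_def] using this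
    obtain ⟨R, hR⟩ := eventually_atTop.1 (hs.eventually (gt_mem_nhds (half_pos hσ)))
    have hpos (r : ℝ) (hr : max R 1 < r) : 0 < r ∧ R ≤ r :=
      ⟨by linarith [le_max_right R 1], by linarith [le_max_left R 1]⟩
    obtain ⟨C, hC⟩ := le_exp_of_deriv_two_ge (μ := √σ) (R := max R 1)
      (fun r hr => h1 r (hpos r hr).1) (fun r hr => h2 r (hpos r hr).1)
      (fun r hr => hf₁ r (hpos r hr).1) (fun r hr => by
        obtain ⟨hr0, hr1⟩ := hpos r hr
        rw [Real.sq_sqrt hσ.le]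
        have h3 := heq r hr0
        have h4 : f₁ r / r ≤ 0 := div_nonpos_of_nonpos_of_nonneg (hf₁ r hr0) hr0.le
        nlinarith [hR r hr1, hf r hr0]) hf0
    exact ⟨√σ, max R 1 + 1, C, Real.sqrt_pos.2 hσ, by positivity, hC⟩
  · obtain ⟨R, hR⟩ := eventually_atTop.1 (hg0.eventually (gt_mem_nhds one_pos))
    have hpos (r : ℝ) (hr : max R 1 < r) : 0 < r ∧ R ≤ r :=
      ⟨by linarith [le_max_right R 1], by linarith [le_max_left R 1]⟩
    -- The constant is 0 since `f` vanishes here, so the rate 1 is arbitrary. Beyond this radius `g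
    -- < 1`, hence `2g < π` and the sine is nonnegative.
    refine ⟨1, max R 1, 0, one_pos, by positivity, fun r hr => ?_⟩
    rw [zero_mul]
    refine (eq_zero_of_radial_superharmonic (R := max R 1) (by positivity)
      (fun r hr => h1 r (hpos r hr).1) (fun r hr => h2 r (hpos r hr).1)
      (fun r hr => hf r (hpos r hr).1) (fun r hr => hf₁ r (hpos r hr).1) (fun r hr => ?_)
      hf0 hr).le
    obtain ⟨hr0, hr1⟩ := hpos r hr
    rw [heq r hr0]
    have hsin : 0 ≤ Real.sin (2 * g r) :=
      Real.sin_nonneg_of_nonneg_of_le_pi (by linarith [hg r hr0])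
        (by linarith [hR r hr1, Real.pi_gt_three])
    nlinarith [mul_nonneg (hf r hr0) hsin, mul_nonneg (neg_nonneg.2 hσ) (hf r hr0)]

/-- The profile of the second component of a stationary solution decays exponentially, once the
first one does. -/
theorem exists_exp_decay_φ {lam q m R C : ℝ} {f g g₁ g₂ : ℝ → ℝ} (hlam : 0 < lam) (hq : 0 < q)
    (hm : 0 < m) (hR : 0 < R)
    (h1 : ∀ r, 0 < r → HasDerivAt g (g₁ r) r) (h2 : ∀ r, 0 < r → HasDerivAt g₁ (g₂ r) r)
    (hg : ∀ r, 0 < r → 0 ≤ g r) (hg₁ : ∀ r, 0 < r → g₁ r ≤ 0) (hg0 : Tendsto g atTop (𝓝 0))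
    (hf : ∀ r, 0 < r → 0 ≤ f r) (hfC : ∀ r, R < r → f r ≤ C * Real.exp (-m * r))
    (heq : ∀ r, 0 < r → g₂ r + g₁ r / r =
      lam⁻¹ * (q * Real.sin (2 * g r) - 2 * f r ^ 2 * Real.cos (2 * g r))) :
    ∃ μ R' C' : ℝ, 0 < μ ∧ μ ≤ m ∧ 0 < R' ∧ ∀ r, R' < r → g r ≤ C' * Real.exp (-μ * r) := by
  obtain ⟨S, hS⟩ := eventually_atTop.1 (hg0.eventually (gt_mem_nhds (half_pos one_half_pos)))
  have hpos (r : ℝ) (hr : max S R < r) : 0 < r ∧ S ≤ r ∧ R < r :=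
    ⟨by linarith [le_max_right S R], by linarith [le_max_left S R], by linarith [le_max_right S R]⟩
  set κ := q / lam
  have hκ : 0 < κ := by positivity
  set K := 2 * C ^ 2 / lam
  have hK : 0 ≤ K := by positivity
  set μ := min (√κ) m
  have hμ : 0 < μ := lt_min (Real.sqrt_pos.2 hκ) hm
  have hμm : μ ≤ m := min_le_right _ _
  have hμκ : μ ^ 2 ≤ κ := by
    calc μ ^ 2 ≤ √κ ^ 2 := by gcongr; exact min_le_left _ _
      _ = κ := Real.sq_sqrt hκ.le
  have hden : 0 < (2 * m) ^ 2 - μ ^ 2 := by nlinarith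
  -- Chosen so that `B(2m)² = K + Bμ²`: then `g + Be^{-2mr}` satisfies `Q'' ≥ μ²Q`. The denominator
  -- is positive because `μ ≤ m`.
  set B := K / ((2 * m) ^ 2 - μ ^ 2)
  have hB : 0 ≤ B := by positivity
  have hBK : B * (2 * m) ^ 2 = K + B * μ ^ 2 := by
    have : B * ((2 * m) ^ 2 - μ ^ 2) = K := div_mul_cancel₀ _ hden.ne'
    linarith
  set e : ℝ → ℝ := fun r => Real.exp (-(2 * m) * r)
  have he (r : ℝ) : HasDerivAt e (e r * -(2 * m)) r := by
    have h := (hasDerivAt_id r).const_mul (-(2 * m))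
    rw [mul_one] at h
    exact h.exp
  have he0 : Tendsto e atTop (𝓝 0) :=
    Real.tendsto_exp_atBot.comp (tendsto_id.const_mul_atTop_of_neg (by linarith))
  have hlower (r : ℝ) (hr : max S R < r) : κ * g r - K * e r ≤ g₂ r := by
    obtain ⟨hr0, hrS, hrR⟩ := hpos r hr
    have h3 : g₁ r / r ≤ 0 := div_nonpos_of_nonpos_of_nonneg (hg₁ r hr0) hr0.le
    -- Jordan's inequality gives `sin 2g ≥ 4g/π ≥ g`, applicable because `g < 1/4` here.
    have h4 : g r ≤ Real.sin (2 * g r) := by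
      have hgS := hS r hrS
      have h5 := Real.mul_le_sin (x := 2 * g r) (by linarith [hg r hr0])
        (by linarith [Real.pi_gt_three])
      refine le_trans ?_ h5
      have h6 : 1 ≤ 2 / Real.pi * 2 := by
        rw [div_mul_eq_mul_div, le_div_iff₀ Real.pi_pos]
        linarith [Real.pi_lt_four]
      nlinarith [hg r hr0]
    have h5 : f r ^ 2 ≤ C ^ 2 * e r := by
      have h6 : e r = Real.exp (-m * r) ^ 2 := by
        rw [← Real.exp_nat_mul]
        simp only [e]
        congr 1
        push_cast
        ring
      rw [h6, ← mul_pow]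
      exact pow_le_pow_left₀ (hf r hr0) (hfC r hrR) 2
    have h6 : f r ^ 2 * Real.cos (2 * g r) ≤ C ^ 2 * e r :=
      (mul_le_of_le_one_right (sq_nonneg _) (Real.cos_le_one _)).trans h5
    have h7 : κ * g r - K * e r = lam⁻¹ * (q * g r - 2 * (C ^ 2 * e r)) := by
      simp only [κ, K]
      field_simp
    have h8 : lam⁻¹ * (q * g r - 2 * (C ^ 2 * e r)) ≤
        lam⁻¹ * (q * Real.sin (2 * g r) - 2 * f r ^ 2 * Real.cos (2 * g r)) := by
      refine mul_le_mul_of_nonneg_left ?_ (by positivity)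
      nlinarith [mul_le_mul_of_nonneg_left h4 hq.le]
    linarith [heq r hr0]
  obtain ⟨C', hC'⟩ := le_exp_of_deriv_two_ge (μ := μ) (R := max S R)
    (Q := fun r => g r + B * e r) (Q₁ := fun r => g₁ r + B * (e r * -(2 * m)))
    (Q₂ := fun r => g₂ r + B * (e r * -(2 * m) * -(2 * m)))
    (fun r hr => (h1 r (hpos r hr).1).add ((he r).const_mul B))
    (fun r hr => (h2 r (hpos r hr).1).add (((he r).mul_const _).const_mul B))
    (fun r hr => by
      have := hg₁ r (hpos r hr).1
      have : 0 ≤ B * (e r * (2 * m)) := by positivity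
      linarith)
    (fun r hr => by
      have h3 := hlower r hr
      have h4 := mul_le_mul_of_nonneg_right hμκ (hg r (hpos r hr).1)
      have h5 : B * (e r * -(2 * m) * -(2 * m)) = (K + B * μ ^ 2) * e r := by
        rw [← hBK]
        ring
      rw [h5]
      linarith)
    (by simpa using hg0.add (he0.const_mul B))
  refine ⟨μ, max S R + 1, C', hμ, hμm, by positivity, fun r hr => le_trans ?_ (hC' r hr)⟩
  have : 0 ≤ B * e r := by positivity
  linarith

/-- A continuous function dominated by `e^{-m‖x‖}` near infinity is integrable. -/
theorem integrable_of_norm_le_exp_neg {E : Type*} [NormedAddCommGroup E] [NormedSpace ℝ E]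
    [FiniteDimensional ℝ E] [MeasurableSpace E] [BorelSpace E] {μ : Measure E}
    [μ.IsAddHaarMeasure] {u : E → ℝ} (hu : Continuous u) {m R C : ℝ} (hm : 0 < m)
    (h : ∀ x, R < ‖x‖ → |u x| ≤ C * Real.exp (-m * ‖x‖)) : Integrable u μ := by
  set d := Module.finrank ℝ E + 1
  have hint : Integrable (fun x : E => (1 + ‖x‖) ^ (-(d : ℝ))) μ :=
    integrable_one_add_norm (by simp [d])
  have hO : u =O[cocompact E] fun x => (1 + ‖x‖) ^ (-(d : ℝ)) := by
    -- The constant comes from `y^d/d! ≤ e^y` at `y = m(1 + ‖x‖)`; `d` exceeds the dimension, so the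
    -- power is integrable.
    refine Asymptotics.IsBigO.of_bound (|C| * (Real.exp m * d.factorial / m ^ d)) ?_
    filter_upwards [tendsto_norm_cocompact_atTop.eventually_gt_atTop R] with x hx
    have hx0 : 0 < 1 + ‖x‖ := by positivity
    have h1 := Real.pow_div_factorial_le_exp (m * (1 + ‖x‖)) (by positivity) d
    rw [div_le_iff₀ (by positivity), mul_pow] at h1
    have h2 : Real.exp (-m * ‖x‖) * Real.exp (m * (1 + ‖x‖)) = Real.exp m := by
      rw [← Real.exp_add]
      ring_nf
    rw [Real.norm_eq_abs, Real.norm_of_nonneg (by positivity), Real.rpow_neg hx0.le,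
      Real.rpow_natCast]
    calc |u x| ≤ C * Real.exp (-m * ‖x‖) := h x hx
      _ ≤ |C| * Real.exp (-m * ‖x‖) := by gcongr; exact le_abs_self C
      _ ≤ |C| * ((Real.exp m * d.factorial / m ^ d) * ((1 + ‖x‖) ^ d)⁻¹) := by
        gcongr
        rw [← div_eq_mul_inv, div_div, le_div_iff₀ (by positivity)]
        calc _ ≤ Real.exp (-m * ‖x‖) * (Real.exp (m * (1 + ‖x‖)) * d.factorial) := by gcongr
          _ = _ := by rw [← mul_assoc, h2]
      _ = _ := by ring
  exact hu.locallyIntegrable.integrable_of_isBigO_cocompact hO (hint.integrableAtFilter _)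

end Decay

/-! ### Assembly of decay and regularity -/

theorem proposition4 (lam q σ : ℝ) (hlam : 0 < lam) (hq : 0 < q)
    (v φ : Plane → ℝ) (hsol : IsStationarySolution lam q σ v φ)
    (f g : ℝ → ℝ) (hf : IsDecreasingProfile v f) (hg : IsDecreasingProfile φ g) :
    (∀ k : ℕ, MemH k v ∧ MemH k φ) ∧
    ∃ m R C : ℝ, 0 < m ∧ 0 < R ∧ 0 < C ∧ ∀ r : ℝ, R < r →
      |f r| ≤ C * Real.exp (-m * r) ∧ |g r| ≤ C * Real.exp (-m * r) := by
  obtain ⟨hv, -⟩ := id hsol.v_mem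
  obtain ⟨hφ, -⟩ := id hsol.φ_mem
  obtain ⟨hf0, hflim⟩ := hf.nonneg_and_tendsto (memLp_of_memLp_ofReal hv)
  obtain ⟨hg0, hglim⟩ := hg.nonneg_and_tendsto (memLp_of_memLp_ofReal hφ)
  obtain ⟨-, hw⟩ := hsol.weightedIntegrable hlam hv hφ
  obtain ⟨V, Φ, hV, hΦ, hVe, hΦe, hVL, hΦL⟩ := hsol.exists_classical hlam
  have h2 : (2 : WithTop ℕ∞) ≤ ∞ := WithTop.coe_le_coe.2 (le_top : (2 : ℕ∞) ≤ ⊤)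
  have hVf (x : Plane) (hx : x ≠ 0) : V x = f ‖x‖ :=
    IsDecreasingProfile.eq_of_continuous
      ⟨hf.antitoneOn, hVe.trans hf.ae_eq⟩ hV.continuous hx
  have hΦg (x : Plane) (hx : x ≠ 0) : Φ x = g ‖x‖ :=
    IsDecreasingProfile.eq_of_continuous
      ⟨hg.antitoneOn, hΦe.trans hg.ae_eq⟩ hΦ.continuous hx
  obtain ⟨f₁, f₂, hf'⟩ := exists_radial_derivatives (hV.of_le h2) hVf
  obtain ⟨g₁, g₂, hg'⟩ := exists_radial_derivatives (hΦ.of_le h2) hΦg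
  have hpt (r : ℝ) (hr : 0 < r) : V (EuclideanSpace.single 0 r) = f r ∧
      Φ (EuclideanSpace.single 0 r) = g r := by
    have hn : ‖(EuclideanSpace.single 0 r : Plane)‖ = r := by simp [abs_of_pos hr]
    have hne : (EuclideanSpace.single 0 r : Plane) ≠ 0 := by
      rw [← norm_pos_iff, hn]
      exact hr
    exact ⟨by rw [hVf _ hne, hn], by rw [hΦg _ hne, hn]⟩
  have hf₁ (r : ℝ) (hr : 0 < r) : f₁ r ≤ 0 := hf.antitoneOn.hasDerivAt_nonpos hr (hf' r hr).1
  have hg₁ (r : ℝ) (hr : 0 < r) : g₁ r ≤ 0 := hg.antitoneOn.hasDerivAt_nonpos hr (hg' r hr).1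
  obtain ⟨m, R, C, hm, hR, hC⟩ := exists_exp_decay_v (σ := σ) (fun r hr => (hf' r hr).1)
    (fun r hr => (hf' r hr).2.1) hf0 hf₁ hflim hg0 hglim (fun r hr => by
      rw [← (hf' r hr).2.2, hVL, rhsV, (hpt r hr).1, (hpt r hr).2])
  obtain ⟨μ, R', C', hμ, hμm, hR', hC'⟩ := exists_exp_decay_φ hlam hq hm hR
    (fun r hr => (hg' r hr).1) (fun r hr => (hg' r hr).2.1) hg0 hg₁ hglim hf0 hC (fun r hr => by
      rw [← (hg' r hr).2.2, hΦL, rhsφ, (hpt r hr).1, (hpt r hr).2])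
  -- The 1 secures positivity, as `C` may be 0.
  set D := max (max C C') 1
  have hdec (r : ℝ) (hr : max R R' < r) :
      |f r| ≤ D * Real.exp (-μ * r) ∧ |g r| ≤ D * Real.exp (-μ * r) := by
    have hr1 : R < r := (le_max_left _ _).trans_lt hr
    have hr2 : R' < r := (le_max_right _ _).trans_lt hr
    have hr0 : 0 < r := hR.trans hr1
    rw [abs_of_nonneg (hf0 r hr0), abs_of_nonneg (hg0 r hr0)]
    constructor
    · calc f r ≤ C * Real.exp (-m * r) := hC r hr1
        _ ≤ D * Real.exp (-m * r) := by
          gcongr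
          exact (le_max_left _ _).trans (le_max_left _ _)
        _ ≤ D * Real.exp (-μ * r) := by gcongr
    · calc g r ≤ C' * Real.exp (-μ * r) := hC' r hr2
        _ ≤ D * Real.exp (-μ * r) := by
          gcongr
          exact (le_max_right _ _).trans (le_max_left _ _)
  have hRR : 0 < max R R' := lt_max_of_lt_left hR
  have hvi : Integrable v := by
    refine (integrable_of_norm_le_exp_neg hV.continuous hμ (R := max R R') (C := D)
      fun x hx => ?_).congr hVe
    rw [hVf x (norm_pos_iff.1 (hRR.trans hx))]
    exact (hdec _ hx).1
  have hφi : Integrable φ := by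
    refine (integrable_of_norm_le_exp_neg hΦ.continuous hμ (R := max R R') (C := D)
      fun x hx => ?_).congr hΦe
    rw [hΦg x (norm_pos_iff.1 (hRR.trans hx))]
    exact (hdec _ hx).2
  refine ⟨fun k => ⟨memH_of_integrable hv hvi (fun k => (hw k).1) k,
    memH_of_integrable hφ hφi (fun k => (hw k).2) k⟩, μ, max R R', D, hμ, hRR, by positivity, hdec⟩
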